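/- Let $d\ge 1$, let $G=\mathbf F_d$ be the free group on $d$ generators and let $\Omega=\{0,1\}^{\mathbb N}$ be the Cantor space. Let $\Xi_{\min}(G)$ be the space of all minimal actions $\xi\colon G\to \mathrm{Homeo}(\Omega)$ (an action is minimal if finitely many translates of every non-empty open set cover the space), with the topology induced from $\mathrm{Homeo}(\Omega)^G$, where $\mathrm{Homeo}(\Omega)$ carries the topology of uniform convergence. The conjugacy class of $\xi$ is the set of all actions $g\mapsto f\,\xi(g)\,f^{-1}$ with $f\in \mathrm{Homeo}(\Omega)$. A subshift is a non-empty closed subset $X\subseteq A^G$, with $A$ a finite alphabet, invariant under the shift $(g\cdot x)(h)=x(g^{-1}h)$. It is of finite type if it is the set of all $x \in A^G$ in which none of finitely many given patterns (maps $p\colon F\to A$ with $F\subseteq G$ finite) occurs, where $p$ occurs in $x$ if $(g\cdot x)|_F=p$ for some $g\in G$. It is sofic if it is the image of a subshift of finite type (over some finite alphabet) under a continuous $G$-equivariant map. A zero-dimensional compact $G$-flow is identified, through Stone duality, with the Boolean $G$-algebra of its clopen subsets, that is, a structure in the language consisting of the symbols $0,1,\cap,\cup,\neg$ and a unary function symbol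 for every $g\in G$. Then: 1. The sofic minimal subshifts of $G$ (more precisely, the Boolean $G$-algebras isomorphic to the algebra of clopen subsets of a sofic minimal subshift over some finite alphabet) form a Fraïssé class: a non-empty class of finitely generated structures with countably many isomorphism types and the hereditary, joint embedding and amalgamation properties. 2. There is a conjugacy class in $\Xi_{\min}(G)$ which is comeager in $\Xi_{\min}(G)$ and such that, for every $\xi$ in it, the Boolean $G$-algebra of clopen subsets of $\Omega$ with the action $\xi$ is the Fraïssé limit of this class, that is, the (unique) countable ultrahomogeneous structure whose finitely generated substructures are, up to isomorphism, exactly the members of the class. -/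

import Mathlib

open Set TopologicalSpace
open scoped FirstOrder

/-! ### Flows -/

/-- A `G`-flow on the space `Z`: an action of `G` on `Z` by homeomorphisms. (Compactness,
the Hausdorff property and non-emptiness hold for all the spaces `Z` used below.) -/
abbrev GFlow (G Z : Type) [Group G] [TopologicalSpace Z] : Type := G →* (Z ≃ₜ Z)

namespace GFlow

variable {G Z W : Type} [Group G] [TopologicalSpace Z] [TopologicalSpace W]

/-- A flow is minimal if every non-empty open set is syndetic, that is, finitely many of its
translates cover the space. -/
def IsMinimal (ρ : GFlow G Z) : Prop :=
  ∀ U : Set Z, IsOpen U → U.Nonempty → ∃ F : Finset G, ⋃ g ∈ F, ρ g '' U = univ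

/-- `σ` is a factor of `ρ`: there is a continuous, equivariant surjection from `Z` to `W`. -/
def HasFactor (ρ : GFlow G Z) (σ : GFlow G W) : Prop :=
  ∃ φ : Z → W, Continuous φ ∧ Function.Surjective φ ∧ ∀ g z, φ (ρ g z) = σ g (φ z)

end GFlow

/-! ### Boolean `G`-algebras -/

/-- The function symbols of the language of Boolean `G`-algebras: those of Boolean algebras and
a unary symbol for each element of `G`. -/
inductive BoolActFunc (G : Type) : ℕ → Type
  | bot : BoolActFunc G 0
  | top : BoolActFunc G 0
  | inf : BoolActFunc G 2
  | sup : BoolActFunc G 2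
  | compl : BoolActFunc G 1
  | act (g : G) : BoolActFunc G 1

/-- The language of Boolean `G`-algebras. It has no relation symbols. -/
def boolActLang (G : Type) : FirstOrder.Language.{0, 0} := ⟨BoolActFunc G, fun _ => Empty⟩

instance countable_boolActFunc (G : Type) [Countable G] :
    Countable (Σ l, (boolActLang G).Functions l) := by
  have h : Function.Surjective
      (fun s : Option (Option (Option (Option (Option G)))) =>
        match s with
        | none => (⟨0, BoolActFunc.bot⟩ : Σ l, BoolActFunc G l)
        | some none => ⟨0, BoolActFunc.top⟩
        | some (some none) => ⟨2, BoolActFunc.inf⟩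
        | some (some (some none)) => ⟨2, BoolActFunc.sup⟩
        | some (some (some (some none))) => ⟨1, BoolActFunc.compl⟩
        | some (some (some (some (some g)))) => ⟨1, BoolActFunc.act g⟩) := by
    rintro ⟨_, _ | _ | _ | _ | _ | g⟩
    · exact ⟨none, rfl⟩
    · exact ⟨some none, rfl⟩
    · exact ⟨some (some none), rfl⟩
    · exact ⟨some (some (some none)), rfl⟩
    · exact ⟨some (some (some (some none))), rfl⟩
    · exact ⟨some (some (some (some (some g)))), rfl⟩
  exact h.countable

section ClopenAlg

variable {G Z : Type} [Group G] [TopologicalSpace Z]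

/-- The algebra of clopen subsets of the space of the flow `ρ`, the Stone dual of `ρ`. -/
def ClopenAlg (_ρ : GFlow G Z) : Type := Clopens Z

/-- The translate of a clopen set by an element of `G`. -/
def clopenTranslate (ρ : GFlow G Z) (g : G) (U : Clopens Z) : Clopens Z :=
  ⟨ρ g '' (U : Set Z), (ρ g).isClosed_image.2 U.isClopen.1, (ρ g).isOpen_image.2 U.isClopen.2⟩

/-- The clopen sets of a flow form a Boolean `G`-algebra. -/
instance clopenAlgStructure (ρ : GFlow G Z) : (boolActLang G).Structure (ClopenAlg ρ) where
  funMap f v :=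
    match f with
    | BoolActFunc.bot => (⊥ : Clopens Z)
    | BoolActFunc.top => (⊤ : Clopens Z)
    | BoolActFunc.inf => ((v 0 : Clopens Z) ⊓ (v 1 : Clopens Z) : Clopens Z)
    | BoolActFunc.sup => ((v 0 : Clopens Z) ⊔ (v 1 : Clopens Z) : Clopens Z)
    | BoolActFunc.compl => ((v 0 : Clopens Z)ᶜ : Clopens Z)
    | BoolActFunc.act g => clopenTranslate ρ g (v 0)
  RelMap r := r.elim

end ClopenAlg

/-! ### Subshifts -/

/-- The left shift action of `G` on `G → A`, given by `(g • x) h = x (g⁻¹ * h)`. -/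
def shift {G A : Type} [Group G] (g : G) (x : G → A) : G → A := fun h => x (g⁻¹ * h)

/-- A subshift: a non-empty, closed, shift-invariant subset of `G → A` with the product topology.
It is meant for a finite, discrete alphabet `A`. -/
structure Subshift (G A : Type) [Group G] [TopologicalSpace A] where
  carrier : Set (G → A)
  nonempty' : carrier.Nonempty
  isClosed' : IsClosed carrier
  invariant' : ∀ (g : G), ∀ x ∈ carrier, shift g x ∈ carrier

/-- The cylinder of points of `G → A` extending the pattern `p.2` with finite support `p.1`. -/
def cylinder {G A : Type} (p : Σ F : Finset G, (F → A)) : Set (G → A) :=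
  {x | ∀ h : p.1, x h = p.2 h}

namespace Subshift

variable {G A : Type} [Group G] [TopologicalSpace A]

/-- The restriction of the shift action to a subshift. -/
def flow (X : Subshift G A) : GFlow G X.carrier where
  toFun g :=
    { toFun := fun x => ⟨shift g x.1, X.invariant' g x.1 x.2⟩
      invFun := fun x => ⟨shift g⁻¹ x.1, X.invariant' g⁻¹ x.1 x.2⟩
      left_inv := fun x => by ext h; simp [shift]
      right_inv := fun x => by ext h; simp [shift]
      continuous_toFun := by
        refine Continuous.subtype_mk (continuous_pi fun h => ?_) _
        exact (continuous_apply (g⁻¹ * h)).comp continuous_subtype_val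
      continuous_invFun := by
        refine Continuous.subtype_mk (continuous_pi fun h => ?_) _
        exact (continuous_apply (g⁻¹⁻¹ * h)).comp continuous_subtype_val }
  map_one' := by ext x h; simp [shift]
  map_mul' g g' := by ext x h; simp [shift, mul_assoc]

/-- `X` is of finite type: it is the largest subshift in which none of the patterns from some
finite set `P` occurs. -/
def IsSFT (X : Subshift G A) : Prop :=
  ∃ P : Set (Σ F : Finset G, (F → A)), P.Finite ∧
    X.carrier = (⋃ p ∈ P, ⋃ g : G, shift g '' cylinder p)ᶜ

/-- `X` is sofic: it is a factor of a subshift of finite type over some finite alphabet. -/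
def IsSofic (X : Subshift G A) : Prop :=
  ∃ (B : Type) (_ : Finite B) (_ : TopologicalSpace B) (_ : DiscreteTopology B)
    (Y : Subshift G B), Y.IsSFT ∧ Y.flow.HasFactor X.flow

end Subshift

/-- The class of sofic minimal subshifts of `G` over finite alphabets, seen as a class of
Boolean `G`-algebras (up to isomorphism) through Stone duality. -/
def soficMinimalClass (G : Type) [Group G] :
    Set (CategoryTheory.Bundled.{0} (boolActLang G).Structure) :=
  {M | ∃ (A : Type) (_ : Finite A) (_ : TopologicalSpace A) (_ : DiscreteTopology A)
      (X : Subshift G A), X.IsSofic ∧ X.flow.IsMinimal ∧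
        Nonempty (M ≃[boolActLang G] ClopenAlg X.flow)}

/-! ### Cantor actions -/

/-- The Cantor space. -/
abbrev CantorΩ : Type := ℕ → Bool

instance countable_clopenAlg_cantor {G : Type} [Group G] (ξ : GFlow G CantorΩ) :
    Countable (ClopenAlg ξ) :=
  (Clopens.countable_iff_secondCountable (X := CantorΩ)).2 inferInstance

/-- The space `Ξ_min(G)` of minimal actions of `G` on the Cantor space by homeomorphisms. -/
def MinCantorAction (G : Type) [Group G] : Type := {ξ : GFlow G CantorΩ // ξ.IsMinimal}

/-- The topology of `Ξ_min(G)`: it is induced from the product of copies, indexed by `G`, of the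
homeomorphism group of the Cantor space with the topology of uniform convergence, which is the
compact-open topology since the Cantor space is compact. -/
instance minCantorActionTopology (G : Type) [Group G] : TopologicalSpace (MinCantorAction G) :=
  TopologicalSpace.induced
    (fun ξ => (fun g => (ξ.1 g : C(CantorΩ, CantorΩ)) : G → C(CantorΩ, CantorΩ))) inferInstance

/-- The conjugacy class of `ξ`: all the actions `g ↦ f ∘ ξ g ∘ f⁻¹`, where `f` is a
homeomorphism of the Cantor space. -/
def conjClass {G : Type} [Group G] (ξ : MinCantorAction G) : Set (MinCantorAction G) :=
  {η | ∃ f : CantorΩ ≃ₜ CantorΩ, ∀ g : G, η.1 g = f * ξ.1 g * f⁻¹}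

/-!
# The generic minimal action of a free group on the Cantor space

A generic minimal action `ξ` of the free group `G` on the Cantor space has two properties
(`IsGenericAction`): every clopen partition has a refinement whose itineraries form a minimal
nearest-neighbour shift, and each factor map from a minimal nearest-neighbour shift onto the space
of itineraries of a partition lifts to a factor map defined on the Cantor space. By Stone duality
(`exists_eq_dualEmbedding`) the first property says that the finitely generated subalgebras of the
algebra of `ξ` are dual to sofic minimal subshifts, and the second one provides the extensions
needed for a back-and-forth. So the algebra of a generic action is ultrahomogeneous and its age is
the class of sofic minimal subshifts (`IsGenericAction.isFraisseLimit`). All generic actions are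
conjugate by the uniqueness of Fraïssé limits, and the Fraïssé property of the class
(heredity, joint embedding and amalgamation) is a consequence of the existence of the limit.

The combinatorial core is that over a free group every non-empty shift of finite type contains an
image of a minimal nearest-neighbour shift (`exists_isMinMarkov_map`). The Cayley graph is a
regular tree. Choose a point at infinity, let the label of each vertex also record the direction
of that point, and let it determine, by a fixed transition function, the labels of the neighbours
that are farther away. A finite pattern is then determined by the label of a common ancestor of its
vertices. Hence, if the transition graph is restricted to a terminal strongly connected component,
each pattern of one labelling occurs in all the others (`isMinMarkov_edge`).

Density of the two properties follows. The itineraries of a given action up to a large window are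
the allowed patterns of a shift of finite type, a minimal part of which is realized on the Cantor
space by an action close to the given one (`exists_agree_hasMarkovRefinement`); and a minimal part
of a fibre product of nearest-neighbour shifts gives the lifts (`exists_agree_hasMarkovLift`).
The realization (`exists_minCantorAction_of_range_eq`) rests on the uniqueness of the Cantor space
relative to a clopen partition (`exists_homeomorph_of_range_eq`). Openness holds because the
itineraries of an action that form a minimal nearest-neighbour shift do not change under small
perturbations (`range_code_eq_of_agree`). Finally, the space of minimal actions is a Baire space, so
generic actions exist.
-/

namespace FreeGroupShift

/-! ### Minimal nearest-neighbour shifts over free groups -/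

section Markov

variable {d : ℕ} {A C Q : Type}

/-- The letters of the free group on `d` generators: `(i, true)` stands for the generator `i`
and `(i, false)` for its inverse. -/
abbrev Letter (d : ℕ) : Type := Fin d × Bool

/-- The formal inverse of a letter. -/
def Letter.inv (t : Letter d) : Letter d := (t.1, !t.2)

@[simp] theorem Letter.inv_inv (t : Letter d) : t.inv.inv = t := by simp [Letter.inv]

theorem Letter.inv_ne (t : Letter d) : t.inv ≠ t := by
  rcases t with ⟨i, _ | _⟩ <;> simp [Letter.inv]

/-- The group element represented by a letter. -/
def Letter.elt (t : Letter d) : FreeGroup (Fin d) := FreeGroup.mk [t]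

theorem Letter.elt_inv (t : Letter d) : t.inv.elt = t.elt⁻¹ := by
  simp [Letter.elt, Letter.inv, FreeGroup.inv_mk, FreeGroup.invRev]

@[simp] theorem Letter.elt_mul_inv (t : Letter d) : t.elt * t.inv.elt = 1 := by
  simp [Letter.elt_inv]

@[simp] theorem Letter.inv_elt_mul (t : Letter d) : t.inv.elt * t.elt = 1 := by
  simp [Letter.elt_inv]

theorem mk_cons (t : Letter d) (l : List (Letter d)) :
    FreeGroup.mk (t :: l) = t.elt * FreeGroup.mk l := by
  simp [Letter.elt, FreeGroup.mul_mk]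

/-- Multiplication on the right by a letter either appends this letter to the reduced word, or
deletes the last letter. -/
theorem toWord_mul_elt (g : FreeGroup (Fin d)) (t : Letter d) :
    (g * t.elt).toWord = g.toWord ++ [t] ∨ g.toWord = (g * t.elt).toWord ++ [t.inv] := by
  have hg : FreeGroup.IsReduced g.toWord := FreeGroup.isReduced_toWord
  rcases List.eq_nil_or_concat g.toWord with h | ⟨l, s, h⟩
  · left
    rw [FreeGroup.toWord_mul, h]
    simp [Letter.elt, FreeGroup.toWord_mk]
  · rw [List.concat_eq_append] at h
    by_cases hs : s = t.inv
    · right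
      have hl : FreeGroup.IsReduced l := hg.infix ⟨[], [s], by simp [h]⟩
      have : g * t.elt = FreeGroup.mk l := by
        rw [← FreeGroup.mk_toWord (x := g), h, ← FreeGroup.mul_mk, hs]
        change _ * t.inv.elt * _ = _
        rw [mul_assoc, Letter.inv_elt_mul, mul_one]
      rw [this, FreeGroup.toWord_mk, hl.reduce_eq, h, hs]
    · left
      rw [FreeGroup.toWord_mul]
      change FreeGroup.reduce (_ ++ FreeGroup.toWord (FreeGroup.mk [t])) = _
      rw [FreeGroup.toWord_mk, FreeGroup.reduce_singleton]
      apply FreeGroup.IsReduced.reduce_eq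
      rw [h] at hg ⊢
      refine FreeGroup.IsReduced.append_overlap hg ?_ (by simp)
      simp only [FreeGroup.IsReduced, List.cons_append, List.nil_append, List.isChain_cons_cons,
        List.isChain_singleton, and_true]
      intro h1
      by_contra h2
      apply hs
      rcases s with ⟨s1, s2⟩
      rcases t with ⟨t1, t2⟩
      simp only [Letter.inv, Prod.mk.injEq] at *
      refine ⟨h1, ?_⟩
      cases s2 <;> cases t2 <;> simp_all

/-- The nearest-neighbour shift with transition relations `E`: the labellings of the group in
which the labels of `g` and `g * t` are related by `E t`. -/
def markov (E : Letter d → C → C → Prop) : Set (FreeGroup (Fin d) → C) :=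
  {w | ∀ g t, E t (w g) (w (g * t.elt))}

/-- Since the Cayley graph is a tree, a labelling can be constructed one edge at a time. -/
theorem markov_nonempty (E : Letter d → C → C → Prop) [Nonempty C]
    (hsymm : ∀ t x y, E t x y → E t.inv y x) (hser : ∀ t x, ∃ y, E t x y) :
    (markov E).Nonempty := by
  choose next hnext using hser
  obtain ⟨x₀⟩ := ‹Nonempty C›
  refine ⟨fun g => g.toWord.foldl (fun x t => next t x) x₀, fun g t => ?_⟩
  rcases toWord_mul_elt g t with h | h
  · simp only [h, List.foldl_append, List.foldl_cons, List.foldl_nil]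
    exact hnext _ _
  · simp only [h, List.foldl_append, List.foldl_cons, List.foldl_nil]
    simpa using hsymm _ _ _ (hnext t.inv _)

/-- Minimality of a nearest-neighbour shift, in combinatorial form: it is non-empty and every
finite pattern of one of its points occurs in all of them. -/
def IsMinMarkov (E : Letter d → C → C → Prop) : Prop :=
  (markov E).Nonempty ∧ ∀ w ∈ markov E, ∀ w₀ ∈ markov E, ∀ K : Finset (FreeGroup (Fin d)),
    ∃ g, ∀ k ∈ K, w (g * k) = w₀ k

theorem IsMinMarkov.reindex {E : Letter d → C → C → Prop} (hE : IsMinMarkov E) (e : Q ≃ C) :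
    IsMinMarkov (fun t x y => E t (e x) (e y)) := by
  obtain ⟨⟨w, hw⟩, h⟩ := hE
  refine ⟨⟨e.symm ∘ w, fun g t => by simpa using hw g t⟩, fun v hv v₀ hv₀ K => ?_⟩
  obtain ⟨g, hg⟩ := h (e ∘ v) hv (e ∘ v₀) hv₀ K
  exact ⟨g, fun k hk => e.injective (hg k hk)⟩

section Automaton

/-- The edge relation, going away from a point at infinity, of the labellings of the tree
produced by the transition function `child`. The label of a vertex records in `dir` the letter
that leads one step closer to the point at infinity; the labels of the neighbours in all other
directions are determined by the label of the vertex. -/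
def Down (dir : Q → Letter d) (child : Q → Letter d → Q) (t : Letter d) (x y : Q) : Prop :=
  t ≠ dir x ∧ y = child x t

/-- The symmetrization of `Down`. -/
def Edge (dir : Q → Letter d) (child : Q → Letter d → Q) (t : Letter d) (x y : Q) : Prop :=
  Down dir child t x y ∨ Down dir child t.inv y x

variable {dir : Q → Letter d} {child : Q → Letter d → Q}

theorem down_of_edge (hdir : ∀ x t, t ≠ dir x → dir (child x t) = t.inv) {w : FreeGroup (Fin d) → Q}
    (hw : w ∈ markov (Edge dir child)) {g : FreeGroup (Fin d)} {t : Letter d}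
    (ht : t ≠ dir (w g)) : w (g * t.elt) = child (w g) t := by
  rcases hw g t with h | h
  · exact h.2
  · refine absurd ?_ ht
    rw [h.2, hdir _ _ h.1, Letter.inv_inv]

theorem ne_dir_parent {w : FreeGroup (Fin d) → Q} (hw : w ∈ markov (Edge dir child))
    (g : FreeGroup (Fin d)) :
    (dir (w g)).inv ≠ dir (w (g * (dir (w g)).elt)) := by
  rcases hw g (dir (w g)) with h | h
  · exact absurd rfl h.1
  · exact h.1

/-- `Descends dir w h k`: the vertex `k` is a descendant of `h` in the tree oriented by `w`. -/
inductive Descends (dir : Q → Letter d) (w : FreeGroup (Fin d) → Q) (h : FreeGroup (Fin d)) :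
    FreeGroup (Fin d) → Prop
  | refl : Descends dir w h h
  | step {k : FreeGroup (Fin d)} {t : Letter d} :
      Descends dir w h k → t ≠ dir (w k) → Descends dir w h (k * t.elt)

theorem Descends.trans {w : FreeGroup (Fin d) → Q} {h k l : FreeGroup (Fin d)}
    (hk : Descends dir w h k) (hl : Descends dir w k l) : Descends dir w h l := by
  induction hl with
  | refl => exact hk
  | step _ ht ih => exact ih.step ht

/-- The label of a vertex determines those of its descendants. -/
theorem Descends.label_eq (hdir : ∀ x t, t ≠ dir x → dir (child x t) = t.inv)
    {w w' : FreeGroup (Fin d) → Q} (hw : w ∈ markov (Edge dir child))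
    (hw' : w' ∈ markov (Edge dir child)) {h h' k : FreeGroup (Fin d)} (hk : Descends dir w h k)
    (hh : w' h' = w h) : w' (h' * h⁻¹ * k) = w k := by
  induction hk with
  | refl => simpa using hh
  | @step k t _ ht ih =>
    rw [down_of_edge hdir hw ht, ← mul_assoc, down_of_edge hdir hw' (by rwa [ih]), ih]

/-- The neighbour of a vertex in the direction of the point at infinity. -/
def parent (dir : Q → Letter d) (w : FreeGroup (Fin d) → Q) (g : FreeGroup (Fin d)) :
    FreeGroup (Fin d) :=
  g * (dir (w g)).elt

theorem descends_parent {w : FreeGroup (Fin d) → Q} (hw : w ∈ markov (Edge dir child))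
    (g : FreeGroup (Fin d)) : Descends dir w (parent dir w g) g := by
  have := (Descends.refl (dir := dir) (w := w) (h := parent dir w g)).step (ne_dir_parent hw g)
  simpa [parent, mul_assoc] using this

theorem descends_iterate_parent {w : FreeGroup (Fin d) → Q} (hw : w ∈ markov (Edge dir child))
    (n : ℕ) (g : FreeGroup (Fin d)) : Descends dir w ((parent dir w)^[n] g) g := by
  induction n with
  | zero => exact .refl
  | succ n ih =>
    rw [Function.iterate_succ_apply']
    exact (descends_parent hw _).trans ih

/-- Any two vertices have a common ancestor. -/
theorem exists_iterate_parent_eq (hdir : ∀ x t, t ≠ dir x → dir (child x t) = t.inv)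
    {w : FreeGroup (Fin d) → Q} (hw : w ∈ markov (Edge dir child)) (k : FreeGroup (Fin d)) :
    ∃ n m, (parent dir w)^[n] 1 = (parent dir w)^[m] k := by
  have step : ∀ (k : FreeGroup (Fin d)) (t : Letter d),
      (∃ n m, (parent dir w)^[n] 1 = (parent dir w)^[m] k) →
        ∃ n m, (parent dir w)^[n] 1 = (parent dir w)^[m] (k * t.elt) := by
    rintro k t ⟨n, m, h⟩
    by_cases ht : t = dir (w k)
    · have hk : k * t.elt = parent dir w k := by rw [ht]; rfl
      refine ⟨n + 1, m, ?_⟩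
      rw [hk, ← Function.iterate_succ_apply, Function.iterate_succ_apply',
        Function.iterate_succ_apply', h]
    · refine ⟨n, m + 1, ?_⟩
      rw [h, Function.iterate_succ_apply]
      congr 1
      simp [parent, down_of_edge hdir hw ht, hdir _ _ ht, mul_assoc]
  have key : ∀ (l : List (Letter d)) (k : FreeGroup (Fin d)),
      (∃ n m, (parent dir w)^[n] 1 = (parent dir w)^[m] k) →
        ∃ n m, (parent dir w)^[n] 1 = (parent dir w)^[m] (k * FreeGroup.mk l) := by
    intro l
    induction l with
    | nil => intro k hk; simpa [← FreeGroup.one_eq_mk] using hk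
    | cons t l ih =>
      intro k hk
      rw [mk_cons, ← mul_assoc]
      exact ih _ (step k t hk)
  have := key k.toWord 1 ⟨0, 0, rfl⟩
  rwa [FreeGroup.mk_toWord, one_mul] at this

theorem exists_common_ancestor (hdir : ∀ x t, t ≠ dir x → dir (child x t) = t.inv)
    {w : FreeGroup (Fin d) → Q} (hw : w ∈ markov (Edge dir child))
    (K : Finset (FreeGroup (Fin d))) : ∃ h, ∀ k ∈ K, Descends dir w h k := by
  have h1 : ∀ k, ∃ n, Descends dir w ((parent dir w)^[n] 1) k := by
    intro k
    obtain ⟨n, m, h⟩ := exists_iterate_parent_eq hdir hw k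
    exact ⟨n, h ▸ descends_iterate_parent hw m k⟩
  choose N hN using h1
  refine ⟨(parent dir w)^[K.sup N] 1, fun k hk => ?_⟩
  obtain ⟨j, hj⟩ := Nat.exists_eq_add_of_le (Finset.le_sup (f := N) hk)
  rw [hj, Nat.add_comm, Function.iterate_add_apply]
  exact (descends_iterate_parent hw j _).trans (hN k)

/-- If the graph of the transition function is strongly connected, then the shift of the
labellings that it produces is minimal: a finite pattern is determined by the label of a common
ancestor, and every label occurs below every vertex. -/
theorem isMinMarkov_edge [Nonempty Q] (hdir : ∀ x t, t ≠ dir x → dir (child x t) = t.inv)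
    (hconn : ∀ x y, Relation.ReflTransGen (fun x y => ∃ t, Down dir child t x y) x y)
    (hchild : ∀ x, ∃ t, t ≠ dir x) : IsMinMarkov (Edge dir child) := by
  refine ⟨markov_nonempty _ ?_ ?_, fun w hw w₀ hw₀ K => ?_⟩
  · rintro t x y (h | h)
    · exact .inr (by simpa using h)
    · exact .inl h
  · intro t x
    by_cases ht : t = dir x
    · -- A parent of `x` exists: the last step of a path from a child of `x` back to `x`.
      have : ∃ p s, Down dir child s p x := by
        obtain ⟨s, hs⟩ := hchild x
        rcases (hconn (child x s) x).cases_tail with h | ⟨p, -, s', h⟩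
        · exact ⟨x, s, hs, h⟩
        · exact ⟨p, s', h⟩
      obtain ⟨p, s, hs⟩ := this
      refine ⟨p, .inr ?_⟩
      have : t.inv = s := by rw [ht, hs.2, hdir _ _ hs.1, Letter.inv_inv]
      rwa [this]
    · exact ⟨child x t, .inl ⟨ht, rfl⟩⟩
  · obtain ⟨h, hh⟩ := exists_common_ancestor hdir hw₀ K
    have h1 : ∀ y, Relation.ReflTransGen (fun x y => ∃ t, Down dir child t x y) (w 1) y →
        ∃ g, w g = y := by
      intro y hy
      induction hy with
      | refl => exact ⟨1, rfl⟩
      | tail _ hs ih =>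
        obtain ⟨g, hg⟩ := ih
        obtain ⟨t, ht, rfl⟩ := hs
        exact ⟨g * t.elt, by rw [down_of_edge hdir hw (by rwa [hg]), hg]⟩
    obtain ⟨g, hg⟩ := h1 (w₀ h) (hconn _ _)
    exact ⟨g * h⁻¹, fun k hk => (hh k hk).label_eq hdir hw₀ hw hg⟩

end Automaton

/-- In a finite directed graph some vertex can be reached from all the vertices that it
reaches. -/
theorem exists_terminal [Finite Q] [Nonempty Q] (r : Q → Q → Prop) :
    ∃ x, ∀ y, Relation.ReflTransGen r x y → Relation.ReflTransGen r y x := by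
  obtain ⟨x, hx⟩ := Finite.exists_min fun x => {y | Relation.ReflTransGen r x y}.ncard
  refine ⟨x, fun y hy => ?_⟩
  have hsub : {z | Relation.ReflTransGen r y z} ⊆ {z | Relation.ReflTransGen r x z} :=
    fun z hz => Relation.ReflTransGen.trans hy hz
  have heq := Set.eq_of_subset_of_ncard_le hsub (hx y) (Set.toFinite _)
  have : x ∈ {z | Relation.ReflTransGen r x z} := Relation.ReflTransGen.refl
  rw [← heq] at this
  exact this

/-- A symmetric family of neighbour relations without dead ends on a finite alphabet admits
labellings that form a minimal nearest-neighbour shift, up to an enlargement of the alphabet: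
choose a point at infinity and let the label of each vertex determine the labels of those of its
neighbours that are farther away from this point. -/
theorem exists_isMinMarkov [Finite A] [Nonempty A] (hd : 1 ≤ d) (D : Letter d → A → A → Prop)
    (hsymm : ∀ t a b, D t a b → D t.inv b a) (hser : ∀ t a, ∃ b, D t a b) :
    ∃ (m : ℕ) (E : Letter d → Fin m → Fin m → Prop) (κ : Fin m → A), IsMinMarkov E ∧
      ∀ t i j, E t i j → D t (κ i) (κ j) := by
  have : Nonempty (Letter d) := ⟨(⟨0, hd⟩, true)⟩
  choose c hc using hser
  let dir₀ : A × Letter d → Letter d := Prod.snd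
  let child₀ : A × Letter d → Letter d → A × Letter d := fun x t => (c t x.1, t.inv)
  obtain ⟨x₀, hx₀⟩ := exists_terminal fun x y => ∃ t, Down dir₀ child₀ t x y
  let Q := {y // Relation.ReflTransGen (fun x y => ∃ t, Down dir₀ child₀ t x y) x₀ y}
  let dir : Q → Letter d := fun x => x.1.2
  classical
  let child : Q → Letter d → Q := fun x t =>
    if ht : t ≠ dir x then ⟨child₀ x.1 t, x.2.tail ⟨t, ht, rfl⟩⟩ else x
  have hchild : ∀ x t, t ≠ dir x → (child x t).1 = child₀ x.1 t := by
    intro x t ht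
    simp only [child, dif_pos ht]
  have hdir : ∀ x t, t ≠ dir x → dir (child x t) = t.inv := by
    intro x t ht
    change (child x t).1.2 = _
    rw [hchild x t ht]
  have hlift : ∀ (x : Q) (y : A × Letter d)
      (_ : Relation.ReflTransGen (fun x y => ∃ t, Down dir₀ child₀ t x y) x.1 y),
      ∃ hy, Relation.ReflTransGen (fun x y => ∃ t, Down dir child t x y) x ⟨y, hy⟩ := by
    intro x y hxy
    induction hxy with
    | refl => exact ⟨x.2, .refl⟩
    | @tail y z _ hs ih =>
      obtain ⟨hy, ih⟩ := ih
      obtain ⟨t, ht, hz⟩ := hs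
      refine ⟨hy.tail ⟨t, ht, hz⟩, ih.tail ⟨t, ht, Subtype.ext ?_⟩⟩
      exact hz.trans (hchild ⟨y, hy⟩ t ht).symm
  have hconn : ∀ x y, Relation.ReflTransGen (fun x y => ∃ t, Down dir child t x y) x y :=
    fun x y => (hlift x y.1 ((hx₀ _ x.2).trans y.2)).2
  have hne : Nonempty Q := ⟨⟨x₀, .refl⟩⟩
  have hmin : IsMinMarkov (Edge dir child) := by
    refine isMinMarkov_edge hdir hconn fun x => ⟨(dir x).inv, Letter.inv_ne _⟩
  obtain ⟨m, ⟨e⟩⟩ := Finite.exists_equiv_fin Q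
  have hdown : ∀ t x y, Down dir child t x y → D t x.1.1 y.1.1 := by
    rintro t x y ⟨ht, rfl⟩
    rw [hchild x t ht]
    exact hc t x.1.1
  refine ⟨m, _, fun i => (e.symm i).1.1, hmin.reindex e.symm, ?_⟩
  rintro t i j (h | h)
  · exact hdown _ _ _ h
  · simpa using hsymm _ _ _ (hdown _ _ _ h)

end Markov

/-! ### Minimal parts of shifts of finite type -/

section FiniteType

variable {d : ℕ} {A C Z : Type}

/-- The itinerary of the point `z` of a flow, with respect to the partition of the space into the
fibres of `q`. It is the equivariant map to the full shift determined by `q`. -/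
def code {G : Type} [Group G] [TopologicalSpace Z] (ρ : GFlow G Z) (q : Z → A) (z : Z) : G → A :=
  fun g => q (ρ g⁻¹ z)

section Code

variable {G : Type} [Group G] [TopologicalSpace Z] (ρ : GFlow G Z) (q : Z → A)

@[simp] theorem code_one (z : Z) : code ρ q z 1 = q z := by simp [code]

theorem code_apply (z : Z) (g : G) : code ρ q (ρ g z) = shift g (code ρ q z) := by
  funext h
  simp only [code, shift, mul_inv_rev, inv_inv, map_mul]
  rfl

theorem continuous_code [TopologicalSpace A] (hq : Continuous q) : Continuous (code ρ q) :=
  continuous_pi fun g => hq.comp (ρ g⁻¹).continuous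

end Code

@[simp] theorem shift_apply {G : Type} [Group G] (g h : G) (x : G → A) :
    shift g x h = x (g⁻¹ * h) := rfl

@[simp] theorem shift_shift {G : Type} [Group G] (g h : G) (x : G → A) :
    shift g (shift h x) = shift (g * h) x := by
  funext k; simp [mul_assoc]

@[simp] theorem shift_one {G : Type} [Group G] (x : G → A) : shift 1 x = x := by
  funext k; simp

theorem shift_mem_markov (E : Letter d → A → A → Prop) (g : FreeGroup (Fin d))
    {x : FreeGroup (Fin d) → A} (hx : x ∈ markov E) : shift g x ∈ markov E := fun h t => by
  simpa [mul_assoc] using hx (g⁻¹ * h) t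

/-- If a subshift of finite type, presented inside a nearest-neighbour shift `markov E₀` by a
condition `U` on a finite window `B`, is non-empty, then it contains an image of a minimal
nearest-neighbour shift under a relabelling of the symbols. -/
theorem exists_isMinMarkov_map [Finite A] (hd : 1 ≤ d) (E₀ : Letter d → A → A → Prop)
    (U : Set (FreeGroup (Fin d) → A)) (B : Finset (FreeGroup (Fin d)))
    (hU : ∀ x ∈ markov E₀, ∀ y ∈ markov E₀, (∀ h ∈ B, x h = y h) → x ∈ U → y ∈ U)
    (hne : ∃ x ∈ markov E₀, ∀ g, shift g x ∈ U) :
    ∃ (m : ℕ) (E : Letter d → Fin m → Fin m → Prop) (κ : Fin m → A), IsMinMarkov E ∧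
      ∀ w ∈ markov E, κ ∘ w ∈ markov E₀ ∧ κ ∘ w ∈ U := by
  classical
  let X : Set (FreeGroup (Fin d) → A) := {x | x ∈ markov E₀ ∧ ∀ g, shift g x ∈ U}
  -- A finite set of words, closed under tails, that covers the window.
  let 𝓛 : Finset (List (Letter d)) :=
    insert [] (B.biUnion fun b => b.toWord.tails.toFinset)
  have hnil : [] ∈ 𝓛 := Finset.mem_insert_self _ _
  have htail : ∀ t l, t :: l ∈ 𝓛 → l ∈ 𝓛 := by
    intro t l h
    simp only [𝓛, Finset.mem_insert, reduceCtorEq, Finset.mem_biUnion, List.mem_toFinset,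
      List.mem_tails, false_or] at h ⊢
    obtain ⟨b, hb, h⟩ := h
    exact .inr ⟨b, hb, (List.suffix_cons t l).trans h⟩
  have hB : ∀ b ∈ B, b.toWord ∈ 𝓛 := by
    intro b hb
    simp only [𝓛, Finset.mem_insert, Finset.mem_biUnion, List.mem_toFinset, List.mem_tails]
    exact .inr ⟨b, hb, List.suffix_rfl⟩
  let q : (FreeGroup (Fin d) → A) → (𝓛 → A) := fun x l => x (FreeGroup.mk l.1)
  have hXs : ∀ x ∈ X, ∀ g, shift g x ∈ X := fun x hx g =>
    ⟨shift_mem_markov E₀ g hx.1, fun h => by simpa using hx.2 (h * g)⟩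
  obtain ⟨x₀, hx₀⟩ : X.Nonempty := hne
  have : Nonempty (q '' X) := ⟨⟨_, x₀, hx₀, rfl⟩⟩
  obtain ⟨m, E, κ, hE, hEκ⟩ := exists_isMinMarkov (A := q '' X) hd
    (fun t a b => ∃ x ∈ X, q x = a ∧ q (shift t.elt⁻¹ x) = b)
    (by
      rintro t a b ⟨x, hx, ha, hb⟩
      exact ⟨shift t.elt⁻¹ x, hXs x hx _, hb, by simpa [Letter.elt_inv] using ha⟩)
    (by
      rintro t ⟨_, x, hx, rfl⟩
      exact ⟨⟨_, shift t.elt⁻¹ x, hXs x hx _, rfl⟩, x, hx, rfl, rfl⟩)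
  refine ⟨m, E, fun i => (κ i).1 ⟨[], hnil⟩, hE, fun w hw => ?_⟩
  -- Neighbouring windows overlap consistently, so the window of the image of `w` at `g` is `w g`.
  have hwin : ∀ (l : List (Letter d)) (hl : l ∈ 𝓛) (g : FreeGroup (Fin d)),
      (κ (w g)).1 ⟨l, hl⟩ = (κ (w (g * FreeGroup.mk l))).1 ⟨[], hnil⟩ := by
    intro l
    induction l with
    | nil => intro hl g; simp [← FreeGroup.one_eq_mk]
    | cons t l ih =>
      intro hl g
      obtain ⟨x, hx, h1, h2⟩ := hEκ t _ _ (hw g t)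
      rw [mk_cons, ← mul_assoc, ← ih (htail t l hl), ← h1, ← h2]
      simp [q, mk_cons]
  have hmark : (fun i => (κ i).1 ⟨[], hnil⟩) ∘ w ∈ markov E₀ := by
    intro g t
    obtain ⟨x, hx, h1, h2⟩ := hEκ t _ _ (hw g t)
    have := hx.1 1 t
    simp only [Function.comp_apply, ← h1, ← h2]
    simpa [q, ← FreeGroup.one_eq_mk] using this
  refine ⟨hmark, ?_⟩
  obtain ⟨x, hx, h1⟩ := (κ (w 1)).2
  refine hU x hx.1 _ hmark (fun b hb => ?_) (by simpa using hx.2 1)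
  have := hwin b.toWord (hB b hb) 1
  rw [one_mul, FreeGroup.mk_toWord] at this
  rw [Function.comp_apply, ← this, ← h1]
  simp [q, FreeGroup.mk_toWord]

/-- A continuous map from a compact subset of a full shift to a discrete space depends on
finitely many coordinates. -/
theorem exists_window {G D : Type} [TopologicalSpace A] [DiscreteTopology A] [TopologicalSpace D]
    [DiscreteTopology D] {V : Set (G → A)} (hV : IsCompact V) {f : V → D} (hf : Continuous f) :
    ∃ B : Finset G, ∀ x y : V, (∀ h ∈ B, x.1 h = y.1 h) → f x = f y := by
  classical
  have hV' : IsCompact (univ : Set V) := isCompact_iff_isCompact_univ.1 hV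
  have := hV'.induction_on (p := fun s => ∃ B : Finset G, ∀ x ∈ s, ∀ y : V,
    (∀ h ∈ B, x.1 h = y.1 h) → f x = f y) ⟨∅, by simp⟩
    (fun s t hst ⟨B, hB⟩ => ⟨B, fun x hx => hB x (hst hx)⟩)
    (fun s t ⟨B, hB⟩ ⟨B', hB'⟩ => ⟨B ∪ B', fun x hx y hxy => by
      rcases hx with hx | hx
      · exact hB x hx y fun h hh => hxy h (Finset.mem_union_left _ hh)
      · exact hB' x hx y fun h hh => hxy h (Finset.mem_union_right _ hh)⟩)
    (fun x _ => by
      obtain ⟨O, hO, hOf⟩ : ∃ O : Set (G → A), IsOpen O ∧ Subtype.val ⁻¹' O = f ⁻¹' {f x} :=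
        isOpen_induced_iff.1 ((isOpen_discrete {f x}).preimage hf)
      have hxO : x.1 ∈ O := by
        have : x ∈ f ⁻¹' {f x} := rfl
        rwa [← hOf] at this
      obtain ⟨B, u, hu, hB⟩ := isOpen_pi_iff.1 hO x.1 hxO
      have hcyl : ∀ y : V, (∀ h ∈ B, y.1 h = x.1 h) → f y = f x := by
        intro y hy
        have : y ∈ f ⁻¹' {f x} := by
          rw [← hOf]
          exact hB fun h hh => by rw [hy h hh]; exact (hu h hh).2
        exact this
      refine ⟨{y | ∀ h ∈ B, y.1 h = x.1 h}, mem_nhdsWithin_of_mem_nhds ?_, B, ?_⟩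
      · refine IsOpen.mem_nhds ?_ (fun h _ => rfl)
        have : {y : V | ∀ h ∈ B, y.1 h = x.1 h} = ⋂ h ∈ B, {y : V | y.1 h = x.1 h} := by
          ext y; simp
        rw [this]
        refine isOpen_biInter_finset fun h _ => ?_
        have hc : Continuous fun y : V => y.1 h :=
          (continuous_apply h).comp continuous_subtype_val
        exact (isOpen_discrete {x.1 h}).preimage hc
      · intro y hy z hyz
        rw [hcyl y hy, hcyl z fun h hh => (hyz h hh).symm.trans (hy h hh)])
  obtain ⟨B, hB⟩ := this
  exact ⟨B, fun x y => hB x (mem_univ x) y⟩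

end FiniteType

/-! ### Back-and-forth between Cantor spaces -/

section Cantor

variable {X Y : Type} [TopologicalSpace X] [TopologicalSpace Y]

theorem isOpen_fibre {D : Type} [TopologicalSpace D] [DiscreteTopology D] {a : X → D}
    (ha : Continuous a) (s : Set D) : IsOpen (a ⁻¹' s) :=
  (isOpen_discrete s).preimage ha

theorem isClopen_fibre {D : Type} [TopologicalSpace D] [DiscreteTopology D] {a : X → D}
    (ha : Continuous a) (s : Set D) : IsClopen (a ⁻¹' s) :=
  (isClopen_discrete s).preimage ha

/-- In a perfect zero-dimensional space, a non-empty clopen set can be cut into two non-empty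
clopen pieces. -/
theorem exists_isClopen_split [CompactSpace Y] [T2Space Y] [TotallyDisconnectedSpace Y]
    (hperf : ∀ y : Y, ¬ IsOpen {y}) {W : Set Y} (hW : IsClopen W) (hne : W.Nonempty) :
    ∃ V : Set Y, IsClopen V ∧ (W ∩ V).Nonempty ∧ (W ∩ Vᶜ).Nonempty := by
  obtain ⟨y, hy⟩ := hne
  have : ∃ z ∈ W, z ≠ y := by
    by_contra! h
    have : W = {y} := by
      ext z
      exact ⟨fun hz => h z hz, fun hz => by rw [mem_singleton_iff.1 hz]; exact hy⟩
    exact hperf y (this ▸ hW.isOpen)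
  obtain ⟨z, hz, hzy⟩ := this
  obtain ⟨V, hV, hyV, hzV⟩ := exists_isClopen_of_totally_separated hzy.symm
  exact ⟨V, hV, ⟨y, hy, hyV⟩, ⟨z, hz, hzV⟩⟩

/-- One step of the back-and-forth between two Cantor spaces: a clopen set that refines a
partition on one side can be matched on the other side. -/
theorem exists_isClopen_match {X : Type} [CompactSpace Y] [T2Space Y] [TotallyDisconnectedSpace Y]
    (hperf : ∀ y : Y, ¬ IsOpen {y}) {a : X → ℕ} {b : Y → ℕ} (hb : Continuous b)
    (hab : range a = range b) (U : Set X) :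
    ∃ V : Set Y, IsClopen V ∧
      ∀ i, ((∃ x, a x = i ∧ x ∈ U) ↔ ∃ y, b y = i ∧ y ∈ V) ∧
        ((∃ x, a x = i ∧ x ∉ U) ↔ ∃ y, b y = i ∧ y ∉ V) := by
  have h1 : ∀ i, ∃ V : Set Y, IsClopen V ∧
      ((∃ x, a x = i ∧ x ∈ U) ↔ ∃ y, b y = i ∧ y ∈ V) ∧
        ((∃ x, a x = i ∧ x ∉ U) ↔ ∃ y, b y = i ∧ y ∉ V) := by
    intro i
    by_cases hi : ∃ y, b y = i
    · obtain ⟨x₀, hx₀⟩ : i ∈ range a := by rw [hab]; exact hi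
      by_cases hU : ∃ x, a x = i ∧ x ∈ U
      · by_cases hU' : ∃ x, a x = i ∧ x ∉ U
        · obtain ⟨V, hV, ⟨y, hy, hyV⟩, z, hz, hzV⟩ :=
            exists_isClopen_split hperf (isClopen_fibre hb {i}) hi
          exact ⟨V, hV, iff_of_true hU ⟨y, hy, hyV⟩, iff_of_true hU' ⟨z, hz, hzV⟩⟩
        · exact ⟨univ, isClopen_univ, by simpa [hi] using hU, by simpa using hU'⟩
      · refine ⟨∅, isClopen_empty, by simpa using hU, ?_⟩
        have : x₀ ∉ U := fun h => hU ⟨x₀, hx₀, h⟩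
        exact iff_of_true ⟨x₀, hx₀, this⟩ (by simpa using hi)
    · have hi' : ¬ ∃ x, a x = i := by
        intro h
        apply hi
        have : i ∈ range b := by rw [← hab]; exact h
        exact this
      refine ⟨∅, isClopen_empty, iff_of_false ?_ ?_, iff_of_false ?_ ?_⟩
      · rintro ⟨x, hx, -⟩; exact hi' ⟨x, hx⟩
      · simp
      · rintro ⟨x, hx, -⟩; exact hi' ⟨x, hx⟩
      · rintro ⟨x, hx, -⟩; exact hi ⟨x, hx⟩
  choose V hV hVi using h1
  have hfib : ∀ i, {y | y ∈ V (b y)} ∩ b ⁻¹' {i} = V i ∩ b ⁻¹' {i} := by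
    intro i
    ext y
    simp only [mem_inter_iff, mem_ofPred_eq, mem_preimage, mem_singleton_iff, and_congr_left_iff]
    rintro rfl
    exact Iff.rfl
  have hopen : ∀ W : ℕ → Set Y, (∀ i, IsOpen (W i)) → IsOpen {y | y ∈ W (b y)} := by
    intro W hW
    have : {y | y ∈ W (b y)} = ⋃ i, W i ∩ b ⁻¹' {i} := by
      ext y; simp
    rw [this]
    exact isOpen_iUnion fun i => (hW i).inter (isOpen_fibre hb _)
  refine ⟨{y | y ∈ V (b y)}, ⟨⟨?_⟩, hopen V fun i => (hV i).isOpen⟩, fun i => ?_⟩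
  · exact hopen (fun i => (V i)ᶜ) fun i => (hV i).compl.isOpen
  · obtain ⟨h1, h2⟩ := hVi i
    refine ⟨h1.trans ?_, h2.trans ?_⟩
    · exact exists_congr fun y => and_congr_right fun hy => by simp [hy]
    · exact exists_congr fun y => and_congr_right fun hy => by simp [hy]

/-- A matched pair of clopen partitions of two spaces, with pieces labelled by natural
numbers. -/
def IsMatched (p : (X → ℕ) × (Y → ℕ)) : Prop :=
  Continuous p.1 ∧ Continuous p.2 ∧ range p.1 = range p.2

/-- The pair of partitions `p'` refines `p`, compatibly with the matching. -/
def Refines {X Y : Type} (p' p : (X → ℕ) × (Y → ℕ)) : Prop :=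
  ∃ c : ℕ → ℕ, p.1 = c ∘ p'.1 ∧ p.2 = c ∘ p'.2

theorem Refines.trans {X Y : Type} {p p' p'' : (X → ℕ) × (Y → ℕ)} (h : Refines p'' p') (h' : Refines p' p) :
    Refines p'' p := by
  obtain ⟨c, h1, h2⟩ := h
  obtain ⟨c', h1', h2'⟩ := h'
  exact ⟨c' ∘ c, by rw [h1', h1]; rfl, by rw [h2', h2]; rfl⟩

theorem IsMatched.swap {p : (X → ℕ) × (Y → ℕ)} (h : IsMatched p) : IsMatched p.swap :=
  ⟨h.2.1, h.1, h.2.2.symm⟩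

theorem IsMatched.exists_refines [CompactSpace Y] [T2Space Y] [TotallyDisconnectedSpace Y]
    (hperf : ∀ y : Y, ¬ IsOpen {y}) {p : (X → ℕ) × (Y → ℕ)} (hp : IsMatched p)
    {U : Set X} (hU : IsClopen U) :
    ∃ p' : (X → ℕ) × (Y → ℕ), IsMatched p' ∧ Refines p' p ∧ ∃ s, U = p'.1 ⁻¹' s := by
  classical
  obtain ⟨V, hV, h⟩ := exists_isClopen_match hperf hp.2.1 hp.2.2 U
  let e : ℕ × Bool → ℕ := fun x => 2 * x.1 + x.2.toNat
  let a' : X → ℕ := fun x => e (p.1 x, decide (x ∈ U))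
  let b' : Y → ℕ := fun y => e (p.2 y, decide (y ∈ V))
  have hdiv : ∀ n (c : Bool), e (n, c) / 2 = n := by
    intro n c
    have := c.toNat_lt
    simp only [e]
    omega
  have hmod : ∀ n (c : Bool), e (n, c) % 2 = c.toNat := by
    intro n c
    have := c.toNat_lt
    simp only [e]
    omega
  have hdec : ∀ {T : Type} [TopologicalSpace T] {S : Set T}, IsClopen S →
      Continuous fun x => decide (x ∈ S) := by
    intro T _ S hS
    refine continuous_discrete_rng.2 ?_
    rintro (_ | _)
    · convert hS.compl.isOpen using 1
      ext x; simp
    · convert hS.isOpen using 1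
      ext x; simp
  refine ⟨(a', b'), ⟨?_, ?_, ?_⟩, ⟨fun n => n / 2, ?_, ?_⟩, {n | n % 2 = 1}, ?_⟩
  · exact (continuous_of_discreteTopology (f := e)).comp (hp.1.prodMk (hdec hU))
  · exact (continuous_of_discreteTopology (f := e)).comp (hp.2.1.prodMk (hdec hV))
  · ext n
    simp only [mem_range, a', b']
    constructor
    · rintro ⟨x, rfl⟩
      by_cases hx : x ∈ U
      · obtain ⟨y, hy, hyV⟩ := (h (p.1 x)).1.1 ⟨x, rfl, hx⟩
        exact ⟨y, by simp [hy, hyV, hx]⟩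
      · obtain ⟨y, hy, hyV⟩ := (h (p.1 x)).2.1 ⟨x, rfl, hx⟩
        exact ⟨y, by simp [hy, hyV, hx]⟩
    · rintro ⟨y, rfl⟩
      by_cases hy : y ∈ V
      · obtain ⟨x, hx, hxU⟩ := (h (p.2 y)).1.2 ⟨y, rfl, hy⟩
        exact ⟨x, by simp [hy, hxU, hx]⟩
      · obtain ⟨x, hx, hxU⟩ := (h (p.2 y)).2.2 ⟨y, rfl, hy⟩
        exact ⟨x, by simp [hy, hxU, hx]⟩
  · funext x; exact (hdiv _ _).symm
  · funext x; exact (hdiv _ _).symm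
  · ext x
    simp only [mem_preimage, mem_ofPred_eq, a', hmod]
    by_cases hx : x ∈ U <;> simp [hx]

/-- **Uniqueness of the Cantor space**, relative to a clopen partition: matched finite clopen
partitions of two Cantor spaces are carried to each other by a homeomorphism. -/
theorem exists_homeomorph_of_range_eq
    [CompactSpace X] [T2Space X] [TotallyDisconnectedSpace X] [SecondCountableTopology X]
    [CompactSpace Y] [T2Space Y] [TotallyDisconnectedSpace Y] [SecondCountableTopology Y]
    (hX : ∀ x : X, ¬ IsOpen {x}) (hY : ∀ y : Y, ¬ IsOpen {y})
    {a : X → ℕ} {b : Y → ℕ} (ha : Continuous a) (hb : Continuous b) (hab : range a = range b) :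
    ∃ f : X ≃ₜ Y, ∀ x, b (f x) = a x := by
  have hcX : Countable (Clopens X) := Clopens.countable_iff_secondCountable.2 inferInstance
  have hcY : Countable (Clopens Y) := Clopens.countable_iff_secondCountable.2 inferInstance
  obtain ⟨U, hU⟩ := exists_surjective_nat (Clopens X)
  obtain ⟨V, hV⟩ := exists_surjective_nat (Clopens Y)
  have hstep : ∀ (n : ℕ) (p : {p : (X → ℕ) × (Y → ℕ) // IsMatched p}),
      ∃ p' : {p : (X → ℕ) × (Y → ℕ) // IsMatched p}, Refines p'.1 p.1 ∧
        (∃ s, (U n : Set X) = p'.1.1 ⁻¹' s) ∧ ∃ s, (V n : Set Y) = p'.1.2 ⁻¹' s := by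
    rintro n ⟨p, hp⟩
    obtain ⟨p₁, hp₁, h₁, s, hs⟩ := hp.exists_refines hY (U n).isClopen
    obtain ⟨p₂, hp₂, ⟨c, h₂, h₂'⟩, s', hs'⟩ := hp₁.swap.exists_refines hX (V n).isClopen
    refine ⟨⟨p₂.swap, hp₂.swap⟩, Refines.trans ⟨c, h₂', h₂⟩ h₁, ⟨c ⁻¹' s, ?_⟩, s', hs'⟩
    rw [hs]
    have : p₁.1 = c ∘ p₂.2 := h₂'
    rw [this]
    rfl
  choose next hnext using hstep
  obtain ⟨p, hp₀, hps⟩ : ∃ p : ℕ → {p : (X → ℕ) × (Y → ℕ) // IsMatched p},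
      p 0 = ⟨(a, b), ha, hb, hab⟩ ∧ ∀ n, p (n + 1) = next n (p n) :=
    ⟨fun n => Nat.rec ⟨(a, b), ha, hb, hab⟩ next n, rfl, fun _ => rfl⟩
  have hp : ∀ n, Refines (p (n + 1)).1 (p n).1 := fun n => hps n ▸ (hnext n (p n)).1
  have hpU : ∀ n, ∃ s, (U n : Set X) = (p (n + 1)).1.1 ⁻¹' s :=
    fun n => hps n ▸ (hnext n (p n)).2.1
  have hpV : ∀ n, ∃ s, (V n : Set Y) = (p (n + 1)).1.2 ⁻¹' s :=
    fun n => hps n ▸ (hnext n (p n)).2.2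
  -- A point is determined by the labels of the pieces that contain it.
  have hsepX : ∀ x x', (∀ n, (p n).1.1 x = (p n).1.1 x') → x = x' := by
    intro x x' h
    by_contra hne
    obtain ⟨W, hW, hx, hx'⟩ := exists_isClopen_of_totally_separated hne
    obtain ⟨n, hn⟩ := hU ⟨W, hW⟩
    obtain ⟨s, hs⟩ := hpU n
    rw [hn] at hs
    change W = _ at hs
    rw [hs] at hx hx'
    apply hx'
    rw [mem_preimage] at *
    rwa [h] at hx
  have hsepY : ∀ y y', (∀ n, (p n).1.2 y = (p n).1.2 y') → y = y' := by
    intro x x' h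
    by_contra hne
    obtain ⟨W, hW, hx, hx'⟩ := exists_isClopen_of_totally_separated hne
    obtain ⟨n, hn⟩ := hV ⟨W, hW⟩
    obtain ⟨s, hs⟩ := hpV n
    rw [hn] at hs
    change W = _ at hs
    rw [hs] at hx hx'
    apply hx'
    rw [mem_preimage] at *
    rwa [h] at hx
  have hexY : ∀ x, ∃ y, ∀ n, (p n).1.2 y = (p n).1.1 x := by
    intro x
    have := IsCompact.nonempty_iInter_of_sequence_nonempty_isCompact_isClosed
      (fun n => (p n).1.2 ⁻¹' {(p n).1.1 x})
      (fun n y hy => by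
        obtain ⟨c, h1, h2⟩ := hp n
        simp only [mem_preimage, mem_singleton_iff] at hy ⊢
        rw [h1, h2, Function.comp_apply, hy, Function.comp_apply])
      (fun n => by
        have : (p n).1.1 x ∈ range (p n).1.2 := by rw [← (p n).2.2.2]; exact mem_range_self x
        exact this)
      ((isClopen_fibre (p 0).2.2.1 _).isClosed.isCompact)
      (fun n => (isClopen_fibre (p n).2.2.1 _).isClosed)
    obtain ⟨y, hy⟩ := this
    exact ⟨y, fun n => mem_iInter.1 hy n⟩
  have hexX : ∀ y, ∃ x, ∀ n, (p n).1.1 x = (p n).1.2 y := by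
    intro y
    have := IsCompact.nonempty_iInter_of_sequence_nonempty_isCompact_isClosed
      (fun n => (p n).1.1 ⁻¹' {(p n).1.2 y})
      (fun n x hx => by
        obtain ⟨c, h1, h2⟩ := hp n
        simp only [mem_preimage, mem_singleton_iff] at hx ⊢
        rw [h1, h2, Function.comp_apply, hx, Function.comp_apply])
      (fun n => by
        have : (p n).1.2 y ∈ range (p n).1.1 := by rw [(p n).2.2.2]; exact mem_range_self y
        exact this)
      ((isClopen_fibre (p 0).2.1 _).isClosed.isCompact)
      (fun n => (isClopen_fibre (p n).2.1 _).isClosed)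
    obtain ⟨x, hx⟩ := this
    exact ⟨x, fun n => mem_iInter.1 hx n⟩
  choose f hf using hexY
  choose g hg using hexX
  let e : X ≃ Y :=
    { toFun := f
      invFun := g
      left_inv := fun x => hsepX _ _ fun n => by rw [hg, hf]
      right_inv := fun y => hsepY _ _ fun n => by rw [hf, hg] }
  have hbasis : IsTopologicalBasis {s : Set Y | IsClopen s} := isTopologicalBasis_isClopen
  have hcont : Continuous e := by
    refine hbasis.continuous_iff.2 fun W hW => ?_
    obtain ⟨n, hn⟩ := hV ⟨W, hW⟩
    obtain ⟨s, hs⟩ := hpV n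
    rw [hn] at hs
    change W = _ at hs
    have : e ⁻¹' W = (p (n + 1)).1.1 ⁻¹' s := by
      ext x
      rw [hs, mem_preimage, mem_preimage, mem_preimage]
      change (p (n + 1)).1.2 (f x) ∈ s ↔ _
      rw [hf]
    rw [this]
    exact isOpen_fibre (p (n + 1)).2.1 s
  exact ⟨hcont.homeoOfEquivCompactToT2, fun x => by
    have := hf x 0
    rw [hp₀] at this
    exact this⟩

end Cantor

/-! ### Minimal flows and their realization on the Cantor space -/

section Flows

variable {G Z W : Type} [Group G] [TopologicalSpace Z] [TopologicalSpace W]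

theorem flow_mul_apply (ρ : GFlow G Z) (g h : G) (z : Z) : ρ (g * h) z = ρ g (ρ h z) := by
  rw [map_mul]; rfl

@[simp] theorem flow_one_apply (ρ : GFlow G Z) (z : Z) : ρ 1 z = z := by
  rw [map_one]; rfl

@[simp] theorem flow_inv_apply (ρ : GFlow G Z) (g : G) (z : Z) : ρ g⁻¹ (ρ g z) = z := by
  rw [← flow_mul_apply]; simp

@[simp] theorem flow_apply_inv (ρ : GFlow G Z) (g : G) (z : Z) : ρ g (ρ g⁻¹ z) = z := by
  rw [← flow_mul_apply]; simp

/-- A flow on a compact space is minimal if and only if all its orbits are dense. -/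
theorem isMinimal_iff [CompactSpace Z] (ρ : GFlow G Z) :
    ρ.IsMinimal ↔ ∀ (z : Z) (U : Set Z), IsOpen U → U.Nonempty → ∃ g, ρ g z ∈ U := by
  constructor
  · intro h z U hU hne
    obtain ⟨F, hF⟩ := h U hU hne
    have : z ∈ ⋃ g ∈ F, ρ g '' U := by rw [hF]; trivial
    simp only [mem_iUnion] at this
    obtain ⟨g, -, u, hu, rfl⟩ := this
    exact ⟨g⁻¹, by simpa using hu⟩
  · intro h U hU hne
    obtain ⟨F, hF⟩ := isCompact_univ.elim_finite_subcover (fun g => ρ g '' U)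
      (fun g => (ρ g).isOpenMap U hU) (fun z _ => by
        obtain ⟨g, hg⟩ := h z U hU hne
        exact mem_iUnion.2 ⟨g⁻¹, ρ g z, hg, by simp⟩)
    exact ⟨F, univ_subset_iff.1 hF⟩

theorem _root_.GFlow.IsMinimal.eq_univ {ρ : GFlow G Z} (h : ρ.IsMinimal) {S : Set Z}
    (hS : IsClosed S) (hne : S.Nonempty) (hinv : ∀ g, ∀ z ∈ S, ρ g z ∈ S) : S = univ := by
  by_contra hS'
  obtain ⟨F, hF⟩ := h Sᶜ hS.isOpen_compl (nonempty_compl.2 hS')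
  obtain ⟨z, hz⟩ := hne
  have : z ∈ ⋃ g ∈ F, ρ g '' Sᶜ := by rw [hF]; trivial
  simp only [mem_iUnion] at this
  obtain ⟨g, -, u, hu, rfl⟩ := this
  exact hu (by simpa using hinv g⁻¹ _ hz)

/-- An equivariant map into a minimal flow is onto. -/
theorem _root_.GFlow.IsMinimal.surjective [CompactSpace W] [Nonempty W] [T2Space Z] {ρ : GFlow G Z}
    {σ : GFlow G W} (h : ρ.IsMinimal) {φ : W → Z} (hφ : Continuous φ)
    (heq : ∀ g w, φ (σ g w) = ρ g (φ w)) : Function.Surjective φ := by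
  rw [← range_eq_univ]
  refine h.eq_univ (isCompact_range hφ).isClosed (range_nonempty φ) ?_
  rintro g _ ⟨w, rfl⟩
  exact ⟨σ g w, heq g w⟩

theorem _root_.GFlow.IsMinimal.of_factor {ρ : GFlow G Z} {σ : GFlow G W} (h : σ.IsMinimal) {φ : W → Z}
    (hφ : Continuous φ) (hsurj : Function.Surjective φ)
    (heq : ∀ g w, φ (σ g w) = ρ g (φ w)) : ρ.IsMinimal := by
  intro U hU hne
  obtain ⟨F, hF⟩ := h (φ ⁻¹' U) (hU.preimage hφ) (hne.preimage hsurj)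
  refine ⟨F, eq_univ_of_forall fun z => ?_⟩
  obtain ⟨w, rfl⟩ := hsurj z
  have : w ∈ ⋃ g ∈ F, σ g '' (φ ⁻¹' U) := by rw [hF]; trivial
  simp only [mem_iUnion] at this ⊢
  obtain ⟨g, hg, u, hu, rfl⟩ := this
  exact ⟨g, hg, φ u, hu, (heq g u).symm⟩

/-- An infinite minimal flow has no isolated points. -/
theorem _root_.GFlow.IsMinimal.not_isOpen_singleton [Infinite Z] {ρ : GFlow G Z} (h : ρ.IsMinimal) (z : Z) :
    ¬ IsOpen {z} := by
  intro hz
  obtain ⟨F, hF⟩ := h {z} hz (singleton_nonempty z)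
  have : (univ : Set Z).Finite := by
    rw [← hF]
    exact F.finite_toSet.biUnion fun g _ => (finite_singleton z).image _
  exact infinite_univ this

/-- The restriction of a flow to an invariant set. -/
def subflow (ρ : GFlow G Z) (S : Set Z) (hS : ∀ g, ∀ z ∈ S, ρ g z ∈ S) : GFlow G S where
  toFun g :=
    { toFun := fun z => ⟨ρ g z, hS g z z.2⟩
      invFun := fun z => ⟨ρ g⁻¹ z, hS g⁻¹ z z.2⟩
      left_inv := fun z => by simp
      right_inv := fun z => by simp
      continuous_toFun := ((ρ g).continuous.comp continuous_subtype_val).subtype_mk _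
      continuous_invFun := ((ρ g⁻¹).continuous.comp continuous_subtype_val).subtype_mk _ }
  map_one' := by ext z; simp
  map_mul' g h := by ext z; simp

@[simp] theorem coe_subflow_apply (ρ : GFlow G Z) (S : Set Z) (hS : ∀ g, ∀ z ∈ S, ρ g z ∈ S)
    (g : G) (z : S) : (subflow ρ S hS g z : Z) = ρ g z := rfl

/-- The product of two flows. -/
def prodFlow (ρ : GFlow G Z) (σ : GFlow G W) : GFlow G (Z × W) where
  toFun g := (ρ g).prodCongr (σ g)
  map_one' := by ext z <;> simp
  map_mul' g h := by ext z <;> simp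

@[simp] theorem prodFlow_apply (ρ : GFlow G Z) (σ : GFlow G W) (g : G) (z : Z × W) :
    prodFlow ρ σ g z = (ρ g z.1, σ g z.2) := rfl

/-- The transport of a flow along a homeomorphism. -/
def conjFlow (f : Z ≃ₜ W) (ρ : GFlow G Z) : GFlow G W where
  toFun g := f.symm.trans ((ρ g).trans f)
  map_one' := by ext z; simp
  map_mul' g h := by ext z; simp

@[simp] theorem conjFlow_apply (f : Z ≃ₜ W) (ρ : GFlow G Z) (g : G) (w : W) :
    conjFlow f ρ g w = f (ρ g (f.symm w)) := rfl

/-- A flow on a non-empty compact space contains a minimal flow. -/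
theorem exists_minimal_subflow [CompactSpace Z] [T2Space Z] [Nonempty Z] (ρ : GFlow G Z) :
    ∃ (S : Set Z) (hS : ∀ g, ∀ z ∈ S, ρ g z ∈ S), IsClosed S ∧ S.Nonempty ∧
      (subflow ρ S hS).IsMinimal := by
  let 𝒮 : Set (Set Z) := {S | IsClosed S ∧ S.Nonempty ∧ ∀ g, ∀ z ∈ S, ρ g z ∈ S}
  obtain ⟨S, -, hS⟩ := zorn_superset_nonempty 𝒮 (by
    intro c hc hchain hne
    refine ⟨⋂₀ c, ⟨isClosed_sInter fun s hs => (hc hs).1, ?_, ?_⟩, fun s hs => sInter_subset_of_mem hs⟩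
    · have := hne.to_subtype
      exact IsCompact.nonempty_sInter_of_directed_nonempty_isCompact_isClosed
        (fun s hs t ht => (hchain.total hs ht).elim (fun h => ⟨s, hs, subset_rfl, h⟩)
          fun h => ⟨t, ht, h, subset_rfl⟩) (fun s hs => (hc hs).2.1) (fun s hs => (hc hs).1.isCompact)
        (fun s hs => (hc hs).1)
    · intro g z hz s hs
      exact (hc hs).2.2 g z (hz s hs)) univ ⟨isClosed_univ, univ_nonempty, fun _ _ _ => trivial⟩
  obtain ⟨⟨hcl, hne, hinv⟩, hmin⟩ := hS
  have : CompactSpace S := isCompact_iff_compactSpace.1 hcl.isCompact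
  refine ⟨S, hinv, hcl, hne, (isMinimal_iff _).2 fun z U hU hUne => ?_⟩
  -- The points whose orbits avoid `U` form a smaller closed invariant set.
  by_contra! hz
  obtain ⟨O, hO, rfl⟩ := isOpen_induced_iff.1 hU
  let S' : Set Z := {z ∈ S | ∀ g, ρ g z ∉ O}
  have hS' : S' ∈ 𝒮 := by
    refine ⟨?_, ⟨z, z.2, fun g hg => hz g hg⟩, fun g y hy => ⟨hinv g y hy.1, fun h => ?_⟩⟩
    · have : S' = S ∩ ⋂ g, ρ g ⁻¹' Oᶜ := by
        ext y; simp [S']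
      rw [this]
      exact hcl.inter (isClosed_iInter fun g => hO.isClosed_compl.preimage (ρ g).continuous)
    · rw [← flow_mul_apply]
      exact hy.2 _
  obtain ⟨u, hu⟩ := hUne
  have := hmin hS' (fun y hy => hy.1) u.2
  exact this.2 1 (by simpa using hu)

/-- A minimal flow `σ` on a compact metrizable zero-dimensional space extends to a minimal flow
`η` on the Cantor space. If moreover the finite itineraries of `σ` over `F`, with respect to a
clopen partition, are those of a given Cantor flow `ξ`, then `η` can be chosen so that on `F` it
moves the pieces of the partition in the same way as `ξ`. -/
theorem exists_minCantorAction_of_range_eq {A : Type} [Finite A] [TopologicalSpace A]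
    [DiscreteTopology A] [CompactSpace W] [T2Space W] [TotallyDisconnectedSpace W]
    [SecondCountableTopology W] [Nonempty W] (ξ : MinCantorAction G) {σ : GFlow G W}
    (hσ : σ.IsMinimal) {q : CantorΩ → A} (hq : Continuous q) {r : W → A} (hr : Continuous r)
    {F : Finset G} (hF : 1 ∈ F)
    (hrange : range (fun z (g : F) => q (ξ.1 g z)) = range fun w (g : F) => r (σ g w)) :
    ∃ (η : MinCantorAction G) (φ : CantorΩ → W), Continuous φ ∧
      (∀ g z, φ (η.1 g z) = σ g (φ z)) ∧ (∀ z, q z = r (φ z)) ∧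
        ∀ g ∈ F, ∀ z, q (η.1 g z) = q (ξ.1 g z) := by
  obtain ⟨M, hM, hMcl, hMne, hmin⟩ := exists_minimal_subflow (prodFlow σ ξ.1)
  have : CompactSpace M := isCompact_iff_compactSpace.1 hMcl.isCompact
  have : Nonempty M := hMne.to_subtype
  have hfst : Function.Surjective fun m : M => m.1.1 :=
    hσ.surjective (σ := subflow _ M hM) (continuous_fst.comp continuous_subtype_val)
      fun g m => rfl
  have hsnd : Function.Surjective fun m : M => m.1.2 :=
    ξ.2.surjective (σ := subflow _ M hM) (continuous_snd.comp continuous_subtype_val)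
      fun g m => rfl
  have : Infinite M := Infinite.of_surjective _ hsnd
  have hperf : ∀ z : CantorΩ, ¬ IsOpen {z} := ξ.2.not_isOpen_singleton
  obtain ⟨enc, henc⟩ := exists_injective_nat (F → A)
  have ha : Continuous fun m : M => enc fun g : F => r (σ g m.1.1) :=
    (continuous_of_discreteTopology (f := enc)).comp (continuous_pi fun g =>
      hr.comp ((σ g).continuous.comp (continuous_fst.comp continuous_subtype_val)))
  have hb : Continuous fun z : CantorΩ => enc fun g : F => q (ξ.1 g z) :=
    (continuous_of_discreteTopology (f := enc)).comp (continuous_pi fun g =>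
      hq.comp (ξ.1 g).continuous)
  obtain ⟨f, hf⟩ := exists_homeomorph_of_range_eq hmin.not_isOpen_singleton hperf ha hb (by
    change range ((enc ∘ fun w (g : F) => r (σ g w)) ∘ fun m : M => m.1.1) =
      range (enc ∘ fun z (g : F) => q (ξ.1 g z))
    rw [hfst.range_comp, range_comp, range_comp, hrange])
  have hf' : ∀ m : M, ∀ g ∈ F, q (ξ.1 g (f m)) = r (σ g m.1.1) := fun m g hg =>
    congrFun (henc (hf m)) ⟨g, hg⟩
  have hf₁ : ∀ m : M, q (f m) = r m.1.1 := fun m => by simpa using hf' m 1 hF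
  refine ⟨⟨conjFlow f (subflow _ M hM), hmin.of_factor f.continuous f.surjective
    fun g m => by simp⟩, fun z => (f.symm z).1.1,
    continuous_fst.comp (continuous_subtype_val.comp f.symm.continuous), ?_, ?_, ?_⟩
  · intro g z
    simp
  · intro z
    simpa using hf₁ (f.symm z)
  · intro g hg z
    have h1 := hf' (f.symm z) g hg
    rw [f.apply_symm_apply] at h1
    rw [h1]
    simp [hf₁]

end Flows

section MarkovFlow

variable {d : ℕ} {C : Type} [TopologicalSpace C] [DiscreteTopology C]

theorem isClosed_markov (E : Letter d → C → C → Prop) : IsClosed (markov E) := by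
  have : markov E = ⋂ g, ⋂ t, (fun w : FreeGroup (Fin d) → C => (w g, w (g * t.elt))) ⁻¹'
      {p | E t p.1 p.2} := by
    ext w; simp [markov]
  rw [this]
  exact isClosed_iInter fun g => isClosed_iInter fun t => (isClosed_discrete _).preimage
    ((continuous_apply g).prodMk (continuous_apply _))

/-- A non-empty nearest-neighbour shift, as a subshift. -/
def markovSubshift (E : Letter d → C → C → Prop) (hE : (markov E).Nonempty) :
    Subshift (FreeGroup (Fin d)) C where
  carrier := markov E
  nonempty' := hE
  isClosed' := isClosed_markov E
  invariant' g _ hx := shift_mem_markov E g hx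

instance subshift_nonempty {G A : Type} [Group G] [TopologicalSpace A] (X : Subshift G A) :
    Nonempty X.carrier := X.nonempty'.to_subtype

instance subshift_compactSpace {G A : Type} [Group G] [TopologicalSpace A] [Finite A]
    (X : Subshift G A) : CompactSpace X.carrier :=
  isCompact_iff_compactSpace.1 X.isClosed'.isCompact

@[simp] theorem coe_subshift_flow_apply {G A : Type} [Group G] [TopologicalSpace A]
    (X : Subshift G A) (g : G) (x : X.carrier) : (X.flow g x : G → A) = shift g x.1 := rfl

theorem IsMinMarkov.isMinimal [Finite C] {E : Letter d → C → C → Prop} (hE : IsMinMarkov E) :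
    (markovSubshift E hE.1).flow.IsMinimal := by
  refine (isMinimal_iff _).2 fun w U hU ⟨w₀, hw₀⟩ => ?_
  obtain ⟨O, hO, rfl⟩ := isOpen_induced_iff.1 hU
  obtain ⟨K, u, hu, hK⟩ := isOpen_pi_iff.1 hO w₀.1 hw₀
  obtain ⟨g, hg⟩ := hE.2 w.1 w.2 w₀.1 w₀.2 K
  refine ⟨g⁻¹, hK fun k hk => ?_⟩
  have : shift g⁻¹ w.1 k = w₀.1 k := by simpa using hg k hk
  rw [coe_subshift_flow_apply, this]
  exact (hu k hk).2

/-- A nearest-neighbour shift over a finite alphabet is of finite type. -/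
theorem markovSubshift_isSFT [Finite C] (E : Letter d → C → C → Prop)
    (hE : (markov E).Nonempty) : (markovSubshift E hE).IsSFT := by
  classical
  let P : (Letter d × (C × C)) → Σ F : Finset (FreeGroup (Fin d)), (F → C) := fun x =>
    ⟨{1, x.1.elt}, fun h => if h.1 = 1 then x.2.1 else x.2.2⟩
  have hne : ∀ t : Letter d, t.elt ≠ 1 := by
    intro t h
    have := congrArg FreeGroup.toWord h
    rw [Letter.elt, FreeGroup.toWord_mk, FreeGroup.reduce_singleton] at this
    simp at this
  have hP : ∀ t a b (x : FreeGroup (Fin d) → C),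
      x ∈ cylinder (P (t, a, b)) ↔ x 1 = a ∧ x t.elt = b := by
    intro t a b x
    constructor
    · intro h
      have h1 := h ⟨1, by simp [P]⟩
      have h2 := h ⟨t.elt, by simp [P]⟩
      exact ⟨by simpa [P] using h1, by simpa [P, hne] using h2⟩
    · rintro ⟨h1, h2⟩ ⟨h, hh⟩
      simp only [P, Finset.mem_insert, Finset.mem_singleton] at hh
      rcases hh with rfl | rfl
      · simpa [P] using h1
      · simpa [P, hne] using h2
  refine ⟨P '' {x | ¬ E x.1 x.2.1 x.2.2}, (Set.toFinite _).image _, ?_⟩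
  ext x
  simp only [mem_compl_iff, mem_iUnion, not_exists]
  constructor
  · rintro hx _ ⟨⟨t, a, b⟩, hab, rfl⟩ g ⟨y, hy, hgy⟩
    obtain ⟨rfl, rfl⟩ := (hP t a b y).1 hy
    have := hx g t
    rw [← hgy] at this
    simp only [shift_apply, inv_mul_cancel, inv_mul_cancel_left] at this
    exact hab this
  · intro hx g t
    by_contra hg
    exact hx _ ⟨(t, x g, x (g * t.elt)), hg, rfl⟩ g ⟨shift g⁻¹ x, (hP _ _ _ _).2 (by simp), by simp⟩

end MarkovFlow

/-! ### The space of minimal Cantor actions -/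

section Topology

variable {G : Type} [Group G]

/-- An action on the Cantor space, as a family of continuous maps. -/
def toMaps (ξ : MinCantorAction G) : G → C(CantorΩ, CantorΩ) := fun g =>
  (ξ.1 g : C(CantorΩ, CantorΩ))

@[simp] theorem toMaps_apply (ξ : MinCantorAction G) (g : G) (z : CantorΩ) :
    toMaps ξ g z = ξ.1 g z := rfl

theorem isInducing_toMaps : Topology.IsInducing (toMaps (G := G)) := ⟨rfl⟩

theorem toMaps_injective : Function.Injective (toMaps (G := G)) := by
  intro ξ η h
  refine Subtype.ext (MonoidHom.ext fun g => Homeomorph.ext fun z => ?_)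
  have := congrArg (fun f => f g z) h
  exact this

theorem isOpen_setOf_agree {A : Type} [Finite A] [TopologicalSpace A] [DiscreteTopology A]
    {q : CantorΩ → A} (hq : Continuous q) (f₀ : C(CantorΩ, CantorΩ)) :
    IsOpen {f : C(CantorΩ, CantorΩ) | ∀ z, q (f z) = q (f₀ z)} := by
  have : {f : C(CantorΩ, CantorΩ) | ∀ z, q (f z) = q (f₀ z)} =
      ⋂ j : A, {f : C(CantorΩ, CantorΩ) | MapsTo f (f₀ ⁻¹' (q ⁻¹' {j})) (q ⁻¹' {j})} := by
    ext f
    simp only [mem_ofPred_eq, mem_iInter]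
    constructor
    · intro h j z hz
      exact (h z).trans hz
    · intro h z
      exact h (q (f₀ z)) rfl
  rw [this]
  refine isOpen_iInter_of_finite fun j => ContinuousMap.isOpen_setOfPred_mapsTo ?_ (isOpen_fibre hq _)
  exact ((isClopen_fibre hq {j}).isClosed.preimage f₀.continuous).isCompact

/-- The actions that move the pieces of a clopen partition in a prescribed way form an open
set. -/
theorem isOpen_setOf_agree_finset {A : Type} [Finite A] [TopologicalSpace A] [DiscreteTopology A]
    {q : CantorΩ → A} (hq : Continuous q) (ξ : MinCantorAction G) (F : Finset G) :
    IsOpen {η : MinCantorAction G | ∀ g ∈ F, ∀ z, q (η.1 g z) = q (ξ.1 g z)} := by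
  have : {η : MinCantorAction G | ∀ g ∈ F, ∀ z, q (η.1 g z) = q (ξ.1 g z)} =
      ⋂ g ∈ F, (fun η => toMaps η g) ⁻¹' {f | ∀ z, q (f z) = q (toMaps ξ g z)} := by
    ext η; simp
  rw [this]
  exact isOpen_biInter_finset fun g _ => (isOpen_setOf_agree hq _).preimage
    ((continuous_apply g).comp isInducing_toMaps.continuous)

/-- The topology generated by the sets of actions that move the pieces of a clopen partition in a
prescribed way. -/
abbrev agreeTopology : TopologicalSpace (MinCantorAction G) where
  IsOpen O := ∀ ξ ∈ O, ∃ (F : Finset G) (𝒰 : Finset (Clopens CantorΩ)), ∀ η : MinCantorAction G,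
    (∀ g ∈ F, ∀ U ∈ 𝒰, ∀ z, η.1 g z ∈ U ↔ ξ.1 g z ∈ U) → η ∈ O
  isOpen_univ _ _ := ⟨∅, ∅, fun _ _ => trivial⟩
  isOpen_inter O O' h h' ξ hξ := by
    classical
    obtain ⟨F, 𝒰, hF⟩ := h ξ hξ.1
    obtain ⟨F', 𝒰', hF'⟩ := h' ξ hξ.2
    refine ⟨F ∪ F', 𝒰 ∪ 𝒰', fun η hη => ⟨hF η fun g hg U hU => ?_, hF' η fun g hg U hU => ?_⟩⟩
    · exact hη g (Finset.mem_union_left _ hg) U (Finset.mem_union_left _ hU)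
    · exact hη g (Finset.mem_union_right _ hg) U (Finset.mem_union_right _ hU)
  isOpen_sUnion S hS ξ := by
    rintro ⟨O, hO, hξ⟩
    obtain ⟨F, 𝒰, hF⟩ := hS O hO ξ hξ
    exact ⟨F, 𝒰, fun η hη => ⟨O, hO, hF η hη⟩⟩

/-- Every neighbourhood of an action `ξ` contains all the actions that agree with `ξ` on some
finite subset of the group, up to the pieces of some clopen partition. -/
theorem exists_agree_subset {O : Set (MinCantorAction G)} (hO : IsOpen O) {ξ : MinCantorAction G}
    (hξ : ξ ∈ O) : ∃ (F : Finset G) (n : ℕ) (q : CantorΩ → Fin n), Continuous q ∧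
      ∀ η : MinCantorAction G, (∀ g ∈ F, ∀ z, q (η.1 g z) = q (ξ.1 g z)) → η ∈ O := by
  classical
  have hcont : @Continuous _ _ agreeTopology _ (toMaps (G := G)) := by
    let _ : TopologicalSpace (MinCantorAction G) := agreeTopology
    refine continuous_pi fun g => ContinuousMap.continuous_compactOpen.2 fun K hK U hU => ?_
    intro ξ hξ
    obtain ⟨V, hV, hKV, hVU⟩ := exists_clopen_of_closed_subset_open
      (hK.image (ξ.1 g).continuous).isClosed hU (image_subset_iff.2 hξ)
    refine ⟨{g}, {⟨V, hV⟩}, fun η hη z hz => hVU ?_⟩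
    exact (hη g (by simp) ⟨V, hV⟩ (by simp) z).2 (hKV ⟨z, hz, rfl⟩)
  obtain ⟨O', hO', rfl⟩ := isOpen_induced_iff.1 hO
  obtain ⟨F, 𝒰, h⟩ := @IsOpen.preimage _ _ agreeTopology _ _ hcont O' hO' ξ hξ
  obtain ⟨n, ⟨e⟩⟩ := Finite.exists_equiv_fin (𝒰 → Bool)
  refine ⟨F, n, fun z => e fun U => decide (z ∈ U.1), ?_, fun η hη => h η fun g hg U hU z => ?_⟩
  · refine (continuous_of_discreteTopology (f := e)).comp (continuous_pi fun U => ?_)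
    refine continuous_discrete_rng.2 ?_
    rintro (_ | _)
    · convert U.1.isClopen.compl.isOpen using 1
      ext x; simp
    · convert U.1.isClopen.isOpen using 1
      ext x; simp
  · have := congrFun (e.injective (hη g hg z)) ⟨U, hU⟩
    simpa using this

theorem isCompletelyMetrizableSpace_continuousMap (X : Type) [t : TopologicalSpace X]
    [CompactSpace X] [IsCompletelyMetrizableSpace X] : IsCompletelyMetrizableSpace C(X, X) := by
  obtain ⟨m, rfl, -⟩ := IsCompletelyMetrizableSpace.complete (X := X)
  infer_instance

/-- A `Gδ` subset of a completely metrizable space is a Baire space. -/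
theorem _root_.IsGδ.baireSpace_of_isCompletelyMetrizable {X : Type} [TopologicalSpace X]
    [IsCompletelyMetrizableSpace X] {s : Set X} (hs : IsGδ s) : BaireSpace s := by
  have := isClosed_closure (s := s).isCompletelyMetrizableSpace
  have hd : Dense ((↑) ⁻¹' s : Set (closure s)) := by
    refine Subtype.dense_iff.2 fun x hx => ?_
    rwa [Subtype.image_preimage_coe, inter_eq_right.2 subset_closure]
  have := (hs.preimage (continuous_subtype_val (p := (· ∈ closure s)))).baireSpace_of_dense hd
  let f : ((↑) ⁻¹' s : Set (closure s)) ≃ₜ s :=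
    { toFun := fun x => ⟨x.1.1, x.2⟩
      invFun := fun x => ⟨⟨x.1, subset_closure x.2⟩, x.2⟩
      left_inv := fun _ => rfl
      right_inv := fun _ => rfl
      continuous_toFun := by fun_prop
      continuous_invFun := by fun_prop }
  exact f.baireSpace

/-- The families of continuous maps that are minimal actions: those which are multiplicative and
such that finitely many translates of every non-empty clopen set cover the space. -/
theorem range_toMaps : range (toMaps (G := G)) =
    {f | f 1 = ContinuousMap.id _ ∧ ∀ g h, f (g * h) = (f g).comp (f h)} ∩
      ⋂ U : {U : Clopens CantorΩ // U ≠ ⊥}, ⋃ F : Finset G, {f | ∀ z, ∃ g ∈ F, f g z ∈ U.1} := by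
  ext f
  simp only [mem_inter_iff, mem_ofPred_eq, mem_iInter, mem_iUnion, mem_range]
  constructor
  · rintro ⟨ξ, rfl⟩
    refine ⟨⟨?_, fun g h => ?_⟩, fun U => ?_⟩
    · ext1 z; simp
    · ext1 z; simp
    · classical
      have hne : (U.1 : Set CantorΩ).Nonempty := by
        rw [nonempty_iff_ne_empty]
        exact fun h => U.2 (Clopens.ext h)
      obtain ⟨F, hF⟩ := ξ.2 U.1 U.1.isClopen.isOpen hne
      refine ⟨F.image (·⁻¹), fun z => ?_⟩
      have : z ∈ ⋃ g ∈ F, ξ.1 g '' U.1 := by rw [hF]; trivial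
      simp only [mem_iUnion] at this
      obtain ⟨g, hg, u, hu, rfl⟩ := this
      exact ⟨g⁻¹, Finset.mem_image_of_mem _ hg, by simpa using hu⟩
  · rintro ⟨⟨h1, hmul⟩, hU⟩
    have hinv : ∀ g z, f g⁻¹ (f g z) = z := by
      intro g z
      have := hmul g⁻¹ g
      rw [inv_mul_cancel, h1] at this
      exact (congrArg (fun f => f z) this).symm
    let ξ : GFlow G CantorΩ :=
      { toFun := fun g =>
          { toFun := f g
            invFun := f g⁻¹
            left_inv := hinv g
            right_inv := fun z => by simpa using hinv g⁻¹ z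
            continuous_toFun := (f g).continuous
            continuous_invFun := (f g⁻¹).continuous }
        map_one' := Homeomorph.ext fun z => by
          change f 1 z = z
          rw [h1]; rfl
        map_mul' := fun g h => Homeomorph.ext fun z => by
          change f (g * h) z = f g (f h z)
          rw [hmul]; rfl }
    have hξ : ξ.IsMinimal := by
      refine (isMinimal_iff ξ).2 fun z O hO hne => ?_
      obtain ⟨u, hu⟩ := hne
      obtain ⟨V, hV, huV, hVO⟩ := compact_exists_isClopen_in_isOpen hO hu
      obtain ⟨F, hF⟩ := hU ⟨⟨V, hV⟩, fun h => by
        have : V = ∅ := congrArg (fun W : Clopens CantorΩ => (W : Set CantorΩ)) h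
        rw [this] at huV
        exact huV⟩
      obtain ⟨g, -, hg⟩ := hF z
      exact ⟨g, hVO hg⟩
    exact ⟨⟨ξ, hξ⟩, by funext g; ext1 z; rfl⟩

/-- The space of minimal Cantor actions is a Baire space, because it is a `Gδ` subset of a
product of spaces of continuous maps. -/
instance baireSpace_minCantorAction [Countable G] : BaireSpace (MinCantorAction G) := by
  have := isCompletelyMetrizableSpace_continuousMap CantorΩ
  have hc : Countable (Clopens CantorΩ) := Clopens.countable_iff_secondCountable.2 inferInstance
  have hGδ : IsGδ (range (toMaps (G := G))) := by
    rw [range_toMaps]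
    refine IsGδ.inter (IsClosed.isGδ ?_) (IsGδ.iInter_of_isOpen fun U => isOpen_iUnion fun F => ?_)
    · have : {f : G → C(CantorΩ, CantorΩ) | f 1 = ContinuousMap.id _ ∧
          ∀ g h, f (g * h) = (f g).comp (f h)} = {f | f 1 = ContinuousMap.id _} ∩
            ⋂ g, ⋂ h, {f | f (g * h) = (f g).comp (f h)} := by
        ext f; simp
      rw [this]
      refine (isClosed_eq (continuous_apply 1) continuous_const).inter
        (isClosed_iInter fun g => isClosed_iInter fun h => isClosed_eq (continuous_apply _) ?_)
      exact (continuous_apply g).compCM (continuous_apply h)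
    · classical
      refine isOpen_iff_forall_mem_open.2 fun f hf => ?_
      have hq : Continuous fun z : CantorΩ => decide (z ∈ U.1) := by
        refine continuous_discrete_rng.2 ?_
        rintro (_ | _)
        · convert U.1.isClopen.compl.isOpen using 1
          ext x; simp
        · convert U.1.isClopen.isOpen using 1
          ext x; simp
      refine ⟨⋂ g ∈ F, (fun f' => f' g) ⁻¹' {f' | ∀ z, decide (f' z ∈ U.1) = decide (f g z ∈ U.1)},
        ?_, isOpen_biInter_finset fun g _ =>
          (isOpen_setOf_agree hq (f g)).preimage (continuous_apply g), by simp⟩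
      intro f' hf' z
      obtain ⟨g, hg, hgz⟩ := hf z
      refine ⟨g, hg, ?_⟩
      simp only [mem_iInter, mem_preimage, mem_ofPred_eq, decide_eq_decide] at hf'
      exact (hf' g hg z).2 hgz
  have := hGδ.baireSpace_of_isCompletelyMetrizable
  exact (Topology.IsEmbedding.mk isInducing_toMaps toMaps_injective).toHomeomorph.symm.baireSpace

/-- A group with a surjection onto the integers has a minimal action on the Cantor space: an
odometer. -/
theorem nonempty_minCantorAction (φ : G →* Multiplicative ℤ) (hφ : Function.Surjective φ) :
    Nonempty (MinCantorAction G) := by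
  let T := ∀ n : ℕ, Multiplicative (ZMod (n + 1))
  let _ : ∀ n : ℕ, TopologicalSpace (Multiplicative (ZMod (n + 1))) := fun _ => ⊥
  have : ∀ n : ℕ, DiscreteTopology (Multiplicative (ZMod (n + 1))) := fun _ => ⟨rfl⟩
  have : ∀ n : ℕ, Finite (Multiplicative (ZMod (n + 1))) := fun n =>
    inferInstanceAs (Finite (ZMod (n + 1)))
  let ψ : ∀ n : ℕ, Multiplicative ℤ →* Multiplicative (ZMod (n + 1)) := fun n =>
    AddMonoidHom.toMultiplicative (Int.castAddHom (ZMod (n + 1)))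
  let ρ : GFlow G T :=
    { toFun := fun g =>
        { toFun := fun x n => ψ n (φ g) * x n
          invFun := fun x n => ψ n (φ g⁻¹) * x n
          left_inv := fun x => by funext n; simp
          right_inv := fun x => by funext n; simp
          continuous_toFun := continuous_pi fun n =>
            (continuous_of_discreteTopology (f := fun y => ψ n (φ g) * y)).comp (continuous_apply n)
          continuous_invFun := continuous_pi fun n =>
            (continuous_of_discreteTopology (f := fun y => ψ n (φ g⁻¹) * y)).comp
              (continuous_apply n) }
      map_one' := Homeomorph.ext fun x => by funext n; simp
      map_mul' := fun g h => Homeomorph.ext fun x => by funext n; simp [mul_assoc] }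
  obtain ⟨M, hM, hMcl, ⟨x₀, hx₀⟩, hmin⟩ := exists_minimal_subflow ρ
  have : CompactSpace M := isCompact_iff_compactSpace.1 hMcl.isCompact
  have : Infinite M := by
    by_contra hfin
    rw [not_infinite_iff_finite] at hfin
    have hcard : ∀ n : ℕ, n + 1 ≤ Nat.card M := by
      intro n
      have hsurj : Function.Surjective fun m : M => (m.1 n : Multiplicative (ZMod (n + 1))) := by
        intro y
        obtain ⟨k, hk⟩ := ZMod.intCast_surjective (Multiplicative.toAdd (y * (x₀ n)⁻¹))
        obtain ⟨g, hg⟩ := hφ (Multiplicative.ofAdd k)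
        refine ⟨⟨ρ g x₀, hM g x₀ hx₀⟩, ?_⟩
        change ψ n (φ g) * x₀ n = y
        have : ψ n (φ g) = y * (x₀ n)⁻¹ := by
          rw [hg]
          exact congrArg Multiplicative.ofAdd hk
        rw [this, inv_mul_cancel_right]
      have := Nat.card_le_card_of_surjective _ hsurj
      have hz : Nat.card (Multiplicative (ZMod (n + 1))) = n + 1 := Nat.card_zmod (n + 1)
      rwa [hz] at this
    exact absurd (hcard (Nat.card M)) (by omega)
  have hperf : ∀ z : CantorΩ, ¬ IsOpen {z} := by
    intro z hz
    obtain ⟨I, u, hu, hI⟩ := isOpen_pi_iff.1 hz z rfl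
    obtain ⟨n, hn⟩ := Infinite.exists_notMem_finset I
    have : Function.update z n (!z n) ∈ ({z} : Set CantorΩ) := hI fun i hi => by
      have : i ≠ n := fun h => hn (h ▸ hi)
      rw [Function.update_of_ne this]
      exact (hu i hi).2
    have := congrFun (mem_singleton_iff.1 this) n
    simp at this
  have : Nonempty M := ⟨⟨x₀, hx₀⟩⟩
  obtain ⟨f, -⟩ := exists_homeomorph_of_range_eq (a := fun _ : M => 0) (b := fun _ : CantorΩ => 0)
    hmin.not_isOpen_singleton hperf continuous_const continuous_const (by simp)
  exact ⟨⟨conjFlow f (subflow _ M hM), hmin.of_factor f.continuous f.surjective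
    fun g m => by simp⟩⟩

end Topology

/-! ### Generic minimal actions -/

section Generic

variable {d : ℕ}

/-- The inverses of the letters, over which a nearest-neighbour shift is controlled. -/
def letterInvs (d : ℕ) : Finset (FreeGroup (Fin d)) :=
  (Finset.univ : Finset (Letter d)).image fun t => t.elt⁻¹

theorem code_mem_markov {C Z : Type} [TopologicalSpace Z] {ρ : GFlow (FreeGroup (Fin d)) Z}
    {r : Z → C} {E : Letter d → C → C → Prop} (h : ∀ t z, E t (r z) (r (ρ t.elt⁻¹ z))) (z : Z) :
    code ρ r z ∈ markov E := by
  intro g t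
  have := h t (ρ g⁻¹ z)
  rw [← flow_mul_apply, ← mul_inv_rev] at this
  exact this

theorem range_code_eq_markov {C : Type} [TopologicalSpace C] [DiscreteTopology C] [Finite C]
    {ξ : MinCantorAction (FreeGroup (Fin d))} {r : CantorΩ → C} (hr : Continuous r)
    {E : Letter d → C → C → Prop} (hE : IsMinMarkov E)
    (h : ∀ t z, E t (r z) (r (ξ.1 t.elt⁻¹ z))) : range (code ξ.1 r) = markov E := by
  have hmem := code_mem_markov h
  refine Subset.antisymm (range_subset_iff.2 hmem) fun w hw => ?_
  obtain ⟨z, hz⟩ := hE.isMinimal.surjective (σ := ξ.1) (φ := fun z => ⟨code ξ.1 r z, hmem z⟩)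
    ((continuous_code ξ.1 r hr).subtype_mk _)
    (fun g z => Subtype.ext (code_apply ξ.1 r z g)) ⟨w, hw⟩
  exact ⟨z, congrArg Subtype.val hz⟩

/-- If the itineraries of `ξ` form a minimal nearest-neighbour shift, then every action close to
`ξ` has the same itineraries. -/
theorem range_code_eq_of_agree {C : Type} [TopologicalSpace C] [DiscreteTopology C] [Finite C]
    {ξ η : MinCantorAction (FreeGroup (Fin d))} {r : CantorΩ → C} (hr : Continuous r)
    {E : Letter d → C → C → Prop} (hE : IsMinMarkov E) (h : range (code ξ.1 r) = markov E)
    (hη : ∀ g ∈ letterInvs d, ∀ z, r (η.1 g z) = r (ξ.1 g z)) :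
    range (code η.1 r) = markov E := by
  refine range_code_eq_markov hr hE fun t z => ?_
  rw [hη _ (Finset.mem_image_of_mem _ (Finset.mem_univ t))]
  have : code ξ.1 r z ∈ markov E := h ▸ mem_range_self z
  simpa [code] using this 1 t

/-- The partition `q` has a refinement `r` for which the itineraries form a minimal
nearest-neighbour shift. -/
def HasMarkovRefinement (ξ : MinCantorAction (FreeGroup (Fin d))) {n : ℕ}
    (q : CantorΩ → Fin n) : Prop :=
  ∃ (m : ℕ) (E : Letter d → Fin m → Fin m → Prop) (r : CantorΩ → Fin m) (π : Fin m → Fin n),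
    IsMinMarkov E ∧ Continuous r ∧ range (code ξ.1 r) = markov E ∧ q = π ∘ r

theorem isOpen_hasMarkovRefinement {n : ℕ} (q : CantorΩ → Fin n) :
    IsOpen {ξ : MinCantorAction (FreeGroup (Fin d)) | HasMarkovRefinement ξ q} := by
  refine isOpen_iff_forall_mem_open.2 ?_
  rintro ξ ⟨m, E, r, π, hE, hr, h, hq⟩
  exact ⟨_, fun η hη => ⟨m, E, r, π, hE, hr, range_code_eq_of_agree hr hE h hη, hq⟩,
    isOpen_setOf_agree_finset hr ξ (letterInvs d), fun _ _ _ => rfl⟩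

/-- A minimal nearest-neighbour shift whose finite patterns over `F` are, after a relabelling,
those of the itineraries of `ξ` can be realized by an action that agrees with `ξ` on `F`. -/
theorem exists_range_code_eq_markov {A : Type} [Finite A] [TopologicalSpace A]
    [DiscreteTopology A] (ξ : MinCantorAction (FreeGroup (Fin d))) {q : CantorΩ → A}
    (hq : Continuous q) {F : Finset (FreeGroup (Fin d))} (hF : 1 ∈ F) {m : ℕ}
    {E : Letter d → Fin m → Fin m → Prop} (hE : IsMinMarkov E) (κ : Fin m → A)
    (hrange : range (fun z (g : F) => q (ξ.1 g z)) =
      range fun (w : markov E) (g : F) => κ (w.1 g.1⁻¹)) :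
    ∃ (η : MinCantorAction (FreeGroup (Fin d))) (r : CantorΩ → Fin m), Continuous r ∧
      range (code η.1 r) = markov E ∧ q = κ ∘ r ∧ ∀ g ∈ F, ∀ z, q (η.1 g z) = q (ξ.1 g z) := by
  let V := markovSubshift E hE.1
  have hV : (fun (w : V.carrier) (g : F) => κ ((V.flow g w).1 1)) = fun w g => κ (w.1 g.1⁻¹) := by
    funext w g
    rw [coe_subshift_flow_apply, shift_apply, mul_one]
  obtain ⟨η, φ, hφ, heq, hqφ, hag⟩ := exists_minCantorAction_of_range_eq (W := V.carrier) ξ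
    hE.isMinimal hq (r := fun w => κ (w.1 1))
    ((continuous_of_discreteTopology (f := κ)).comp
      ((continuous_apply 1).comp continuous_subtype_val)) hF
    (hrange.trans (congrArg range hV.symm))
  have hcode : ∀ z, code η.1 (fun z => (φ z).1 1) z = (φ z).1 := by
    intro z
    funext g
    change (φ (η.1 g⁻¹ z)).1 1 = _
    rw [heq, coe_subshift_flow_apply, shift_apply, inv_inv, mul_one]
  have hr : Continuous fun z => (φ z).1 1 :=
    (continuous_apply 1).comp (continuous_subtype_val.comp hφ)
  refine ⟨η, fun z => (φ z).1 1, hr, ?_, funext hqφ, hag⟩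
  refine range_code_eq_markov hr hE fun t z => ?_
  have := (φ z).2 1 t
  rw [heq, coe_subshift_flow_apply, shift_apply, inv_inv, mul_one]
  rwa [one_mul] at this

/-- Actions for which a given partition has a refinement with a minimal nearest-neighbour shift
of itineraries are dense. -/
theorem exists_agree_hasMarkovRefinement (hd : 1 ≤ d) (ξ : MinCantorAction (FreeGroup (Fin d)))
    {n : ℕ} {q : CantorΩ → Fin n} (hq : Continuous q) (F : Finset (FreeGroup (Fin d))) :
    ∃ η : MinCantorAction (FreeGroup (Fin d)), HasMarkovRefinement η q ∧
      ∀ g ∈ F, ∀ z, q (η.1 g z) = q (ξ.1 g z) := by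
  classical
  let F' := insert 1 F
  let u : CantorΩ → F' → Fin n := fun z g => q (ξ.1 g z)
  have hu : Continuous u := continuous_pi fun g => hq.comp (ξ.1 g).continuous
  -- By minimality, all patterns over `F'` occur within any sufficiently large window.
  have hK : ∀ z₀, ∃ K : Finset (FreeGroup (Fin d)), ∀ z, ∃ k ∈ K, u (ξ.1 k⁻¹ z) = u z₀ := by
    intro z₀
    obtain ⟨K, hK⟩ := ξ.2 (u ⁻¹' {u z₀}) (isOpen_fibre hu _) ⟨z₀, rfl⟩
    refine ⟨K, fun z => ?_⟩
    have : z ∈ ⋃ g ∈ K, ξ.1 g '' (u ⁻¹' {u z₀}) := by rw [hK]; trivial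
    simp only [mem_iUnion] at this
    obtain ⟨g, hg, y, hy, rfl⟩ := this
    exact ⟨g, hg, by simpa using hy⟩
  choose K hK using hK
  obtain ⟨Z₀, hZ₀⟩ : ∃ Z₀ : Finset CantorΩ, ∀ z, ∃ z₀ ∈ Z₀, u z₀ = u z := by
    choose s hs using fun y : range u => y.2
    have := Fintype.ofFinite (range u)
    exact ⟨Finset.univ.image s, fun z =>
      ⟨s ⟨u z, z, rfl⟩, Finset.mem_image_of_mem _ (Finset.mem_univ _), hs _⟩⟩
  let B : Finset (FreeGroup (Fin d)) :=
    (insert 1 (Z₀.biUnion K)).biUnion fun k => F'.image fun g => k * g⁻¹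
  have hB₁ : ∀ g ∈ F', g⁻¹ ∈ B := fun g hg => Finset.mem_biUnion.2
    ⟨1, Finset.mem_insert_self _ _, Finset.mem_image.2 ⟨g, hg, one_mul _⟩⟩
  have hB₂ : ∀ z₀ ∈ Z₀, ∀ k ∈ K z₀, ∀ g ∈ F', k * g⁻¹ ∈ B := fun z₀ h₀ k hk g hg =>
    Finset.mem_biUnion.2 ⟨k, Finset.mem_insert_of_mem (Finset.mem_biUnion.2 ⟨z₀, h₀, hk⟩),
      Finset.mem_image_of_mem _ hg⟩
  obtain ⟨m, E, κ, hE, hκ⟩ := exists_isMinMarkov_map hd (fun _ _ _ => True)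
    {x | ∃ z, ∀ h ∈ B, x h = code ξ.1 q z h} B
    (by
      rintro x - y - hxy ⟨z, hz⟩
      exact ⟨z, fun h hh => (hxy h hh).symm.trans (hz h hh)⟩)
    ⟨code ξ.1 q (fun _ => false), fun _ _ => trivial, fun g =>
      ⟨ξ.1 g fun _ => false, fun h _ => by rw [code_apply]⟩⟩
  obtain ⟨η, r, hr, hcode, hqr, hag⟩ := exists_range_code_eq_markov ξ hq
    (Finset.mem_insert_self 1 F) hE κ (by
      refine Subset.antisymm ?_ ?_
      · rintro _ ⟨z, rfl⟩
        obtain ⟨z₀, hz₀, hu₀⟩ := hZ₀ z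
        obtain ⟨w, hw⟩ := hE.1
        obtain ⟨-, y, hy⟩ := hκ w hw
        obtain ⟨k, hk, hky⟩ := hK z₀ y
        refine ⟨⟨shift k⁻¹ w, shift_mem_markov E _ hw⟩, ?_⟩
        funext g
        have h1 := hy _ (hB₂ z₀ hz₀ k hk g.1 g.2)
        have h2 := congrFun (hky.trans hu₀) g
        simp only [u, ← flow_mul_apply] at h2
        simp only [Function.comp_apply, code, mul_inv_rev, inv_inv] at h1
        simp only [shift_apply, inv_inv]
        rw [h1, h2]
      · rintro _ ⟨w, rfl⟩
        obtain ⟨-, z, hz⟩ := hκ w.1 w.2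
        refine ⟨z, ?_⟩
        funext g
        have := hz _ (hB₁ g.1 g.2)
        simp only [Function.comp_apply, code, inv_inv] at this
        exact this.symm)
  exact ⟨η, ⟨m, E, r, κ, hE, hr, hcode, hqr⟩, fun g hg => hag g (Finset.mem_insert_of_mem hg)⟩

/-- A witness, stable under small perturbations of `ξ`, for the lifting of the itineraries with
respect to `q` to the nearest-neighbour shift `markov E₂`. -/
def HasMarkovLift (ξ : MinCantorAction (FreeGroup (Fin d))) {n m₂ : ℕ} (q : CantorΩ → Fin n)
    (E₂ : Letter d → Fin m₂ → Fin m₂ → Prop) (p : markov E₂ → Fin n) : Prop :=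
  ∃ (m : ℕ) (E : Letter d → Fin m → Fin m → Prop) (r : CantorΩ → Fin m) (π : Fin m → Fin n)
    (θ : Fin m → Fin m₂), IsMinMarkov E ∧ Continuous r ∧ range (code ξ.1 r) = markov E ∧
      q = π ∘ r ∧ ∀ w ∈ markov E, ∃ h : θ ∘ w ∈ markov E₂, p ⟨θ ∘ w, h⟩ = π (w 1)

theorem isOpen_hasMarkovLift {n m₂ : ℕ} (q : CantorΩ → Fin n)
    (E₂ : Letter d → Fin m₂ → Fin m₂ → Prop) (p : markov E₂ → Fin n) :
    IsOpen {ξ : MinCantorAction (FreeGroup (Fin d)) | HasMarkovLift ξ q E₂ p} := by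
  refine isOpen_iff_forall_mem_open.2 ?_
  rintro ξ ⟨m, E, r, π, θ, hE, hr, h, hq⟩
  exact ⟨_, fun η hη => ⟨m, E, r, π, θ, hE, hr, range_code_eq_of_agree hr hE h hη, hq⟩,
    isOpen_setOf_agree_finset hr ξ (letterInvs d), fun _ _ _ => rfl⟩

/-- Amalgamation: if the itineraries of `ξ` with respect to `q` form a factor of the minimal
nearest-neighbour shift `markov E₂`, then some action close to `ξ` factors onto `markov E₂`
accordingly. It is obtained from a minimal part of the fibre product of `markov E₂` and the
itineraries of `ξ` with respect to a refinement of `q`. -/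
theorem exists_agree_hasMarkovLift (hd : 1 ≤ d) (ξ : MinCantorAction (FreeGroup (Fin d)))
    {n m m₂ : ℕ} {q : CantorΩ → Fin n} {E₂ : Letter d → Fin m₂ → Fin m₂ → Prop}
    (hE₂ : IsMinMarkov E₂) {p : markov E₂ → Fin n} (hp : Continuous p)
    {E : Letter d → Fin m → Fin m → Prop} {r : CantorΩ → Fin m} {π : Fin m → Fin n}
    (hE : IsMinMarkov E) (hr : Continuous r) (hcode : range (code ξ.1 r) = markov E)
    (hq : q = π ∘ r)
    (hrange : range (code ξ.1 q) = range (code (markovSubshift E₂ hE₂.1).flow p))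
    (F : Finset (FreeGroup (Fin d))) :
    ∃ η : MinCantorAction (FreeGroup (Fin d)), HasMarkovLift η q E₂ p ∧
      ∀ g ∈ F, ∀ z, r (η.1 g z) = r (ξ.1 g z) := by
  classical
  have hcpt : IsCompact (markov E₂) := (isClosed_markov E₂).isCompact
  obtain ⟨B, hB⟩ := exists_window hcpt hp
  have hfst : ∀ x ∈ markov (C := Fin m × Fin m₂) fun t a b => E t a.1 b.1 ∧ E₂ t a.2 b.2,
      Prod.fst ∘ x ∈ markov E := fun x hx g t => (hx g t).1
  have hsnd : ∀ x ∈ markov (C := Fin m × Fin m₂) fun t a b => E t a.1 b.1 ∧ E₂ t a.2 b.2,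
      Prod.snd ∘ x ∈ markov E₂ := fun x hx g t => (hx g t).2
  obtain ⟨m₃, E₃, κ, hE₃, hκ⟩ := exists_isMinMarkov_map hd
    (fun t (a b : Fin m × Fin m₂) => E t a.1 b.1 ∧ E₂ t a.2 b.2)
    {x | ∀ h : Prod.snd ∘ x ∈ markov E₂, π (x 1).1 = p ⟨Prod.snd ∘ x, h⟩} (insert 1 B)
    (by
      intro x hx y hy hxy hxU h
      rw [← hxy 1 (Finset.mem_insert_self _ _), hxU (hsnd x hx)]
      refine hB _ _ fun h hh => ?_
      simp only [Function.comp_apply]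
      rw [hxy h (Finset.mem_insert_of_mem hh)])
    (by
      let z : CantorΩ := fun _ => false
      obtain ⟨v, hv⟩ : code ξ.1 q z ∈ range (code (markovSubshift E₂ hE₂.1).flow p) :=
        hrange ▸ mem_range_self z
      have hz : code ξ.1 r z ∈ markov E := hcode ▸ mem_range_self z
      refine ⟨fun g => (code ξ.1 r z g, v.1 g), fun g t => ⟨hz g t, v.2 g t⟩, fun g h => ?_⟩
      have := congrFun hv g⁻¹
      simp only [code, inv_inv, hq, Function.comp_apply] at this
      simp only [code, shift_apply, mul_one, inv_inv]
      exact this.symm)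
  have hπ₁ : ∀ w ∈ markov E₃, (fun g => (κ (w g)).1) ∈ markov E := fun w hw =>
    hfst _ (hκ w hw).1
  have hsurj : ∀ x ∈ markov E, ∃ w ∈ markov E₃, (fun g => (κ (w g)).1) = x := by
    intro x hx
    obtain ⟨w, hw⟩ := hE.isMinimal.surjective (σ := (markovSubshift E₃ hE₃.1).flow)
      (φ := fun w => ⟨fun g => (κ (w.1 g)).1, hπ₁ w.1 w.2⟩)
      (Continuous.subtype_mk (continuous_pi fun g =>
        (continuous_of_discreteTopology (f := fun i => (κ i).1)).comp
          ((continuous_apply g).comp continuous_subtype_val)) _)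
      (fun g w => rfl) ⟨x, hx⟩
    exact ⟨w.1, w.2, congrArg Subtype.val hw⟩
  obtain ⟨η, r₃, hr₃, hcode₃, hr₃', hag⟩ := exists_range_code_eq_markov ξ hr
    (Finset.mem_insert_self 1 F) hE₃ (fun i => (κ i).1) (by
      refine Subset.antisymm ?_ ?_
      · rintro _ ⟨z, rfl⟩
        obtain ⟨w, hw, h⟩ := hsurj (code ξ.1 r z) (hcode ▸ mem_range_self z)
        refine ⟨⟨w, hw⟩, ?_⟩
        funext g
        simpa [code] using congrFun h g.1⁻¹
      · rintro _ ⟨w, rfl⟩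
        obtain ⟨z, hz⟩ : (fun g => (κ (w.1 g)).1) ∈ range (code ξ.1 r) :=
          hcode ▸ hπ₁ w.1 w.2
        refine ⟨z, ?_⟩
        funext g
        simpa [code] using congrFun hz g.1⁻¹)
  refine ⟨η, ⟨m₃, E₃, r₃, fun i => π (κ i).1, fun i => (κ i).2, hE₃, hr₃, hcode₃, ?_, ?_⟩,
    fun g hg => hag g (Finset.mem_insert_of_mem hg)⟩
  · rw [hq, hr₃']
    rfl
  · intro w hw
    obtain ⟨h1, h2⟩ := hκ w hw
    exact ⟨hsnd _ h1, (h2 (hsnd _ h1)).symm⟩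

theorem countable_continuous_fin {Z : Type} [TopologicalSpace Z] [CompactSpace Z] [T2Space Z]
    [TotallyDisconnectedSpace Z] [SecondCountableTopology Z] (n : ℕ) :
    Countable {q : Z → Fin n // Continuous q} := by
  have : Countable (Clopens Z) := Clopens.countable_iff_secondCountable.2 inferInstance
  refine Function.Injective.countable
    (f := fun q (i : Fin n) => (⟨q.1 ⁻¹' {i}, isClopen_fibre q.2 _⟩ : Clopens Z)) ?_
  intro q q' h
  refine Subtype.ext (funext fun z => ?_)
  have h1 : q.1 ⁻¹' {q.1 z} = q'.1 ⁻¹' {q.1 z} :=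
    congrArg (fun U : Clopens Z => (U : Set Z)) (congrFun h (q.1 z))
  have h2 : z ∈ q'.1 ⁻¹' {q.1 z} := h1 ▸ rfl
  exact h2.symm

theorem HasMarkovRefinement.of_comp {ξ : MinCantorAction (FreeGroup (Fin d))} {n n' : ℕ}
    {q : CantorΩ → Fin n} (h : HasMarkovRefinement ξ q) (c : Fin n → Fin n') :
    HasMarkovRefinement ξ (c ∘ q) := by
  obtain ⟨m, E, r, π, hE, hr, hcode, hq⟩ := h
  exact ⟨m, E, r, c ∘ π, hE, hr, hcode, by rw [hq]; rfl⟩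

theorem HasMarkovRefinement.range_code_eq_of_agree {ξ : MinCantorAction (FreeGroup (Fin d))}
    {n : ℕ} {q : CantorΩ → Fin n} (h : HasMarkovRefinement ξ q) :
    ∃ O : Set (MinCantorAction (FreeGroup (Fin d))), IsOpen O ∧ ξ ∈ O ∧
      ∀ η ∈ O, HasMarkovRefinement η q ∧ range (code η.1 q) = range (code ξ.1 q) := by
  obtain ⟨m, E, r, π, hE, hr, hcode, hq⟩ := h
  have hcomp : ∀ η : MinCantorAction (FreeGroup (Fin d)),
      code η.1 q = (fun x g => π (x g)) ∘ code η.1 r := by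
    intro η
    rw [hq]
    rfl
  refine ⟨_, isOpen_setOf_agree_finset hr ξ (letterInvs d), fun _ _ _ => rfl, fun η hη => ?_⟩
  have := FreeGroupShift.range_code_eq_of_agree hr hE hcode hη
  exact ⟨⟨m, E, r, π, hE, hr, this, hq⟩, by rw [hcomp, hcomp, range_comp, range_comp, this, hcode]⟩

/-- For a generic action, if the itineraries with respect to `q` form the prescribed factor of
`markov E₂`, then the factor map lifts. -/
theorem residual_imp_hasMarkovLift (hd : 1 ≤ d) {n m₂ : ℕ} {q : CantorΩ → Fin n} (hq : Continuous q)
    {E₂ : Letter d → Fin m₂ → Fin m₂ → Prop} (hE₂ : IsMinMarkov E₂) {p : markov E₂ → Fin n}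
    (hp : Continuous p) :
    {ξ : MinCantorAction (FreeGroup (Fin d)) |
      range (code ξ.1 q) = range (code (markovSubshift E₂ hE₂.1).flow p) →
        HasMarkovLift ξ q E₂ p} ∈ residual (MinCantorAction (FreeGroup (Fin d))) := by
  let O₁ : Set (MinCantorAction (FreeGroup (Fin d))) := {ξ | HasMarkovRefinement ξ q ∧
    range (code ξ.1 q) ≠ range (code (markovSubshift E₂ hE₂.1).flow p)}
  have hO₁ : IsOpen O₁ := by
    refine isOpen_iff_forall_mem_open.2 fun ξ hξ => ?_
    obtain ⟨O, hO, hξO, h⟩ := hξ.1.range_code_eq_of_agree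
    exact ⟨O, fun η hη => ⟨(h η hη).1, (h η hη).2 ▸ hξ.2⟩, hO, hξO⟩
  refine Filter.mem_of_superset (residual_of_dense_open
    (hO₁.union (isOpen_hasMarkovLift q E₂ p)) ?_) ?_
  · refine dense_iff_inter_open.2 fun O hO ⟨ξ, hξ⟩ => ?_
    obtain ⟨F, n', q', hq', hF⟩ := exists_agree_subset hO hξ
    -- Refine `q` by the partition `q'` that controls the neighbourhood.
    let q'' : CantorΩ → Fin (n * n') := fun z => finProdFinEquiv (q z, q' z)
    have hq'' : Continuous q'' :=
      (continuous_of_discreteTopology (f := finProdFinEquiv)).comp (hq.prodMk hq')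
    obtain ⟨ξ₁, hξ₁, hag₁⟩ := exists_agree_hasMarkovRefinement hd ξ hq'' F
    have hsplit : ∀ z z', q'' z = q'' z' → q' z = q' z' := fun z z' h =>
      congrArg Prod.snd (finProdFinEquiv.injective h)
    have hqc : q = (fun i => (finProdFinEquiv.symm i).1) ∘ q'' := by
      funext z
      exact (congrArg Prod.fst (finProdFinEquiv.symm_apply_apply (q z, q' z))).symm
    have hξ₁O : ξ₁ ∈ O := hF ξ₁ fun g hg z => hsplit _ _ (hag₁ g hg z)
    by_cases hrange : range (code ξ₁.1 q) = range (code (markovSubshift E₂ hE₂.1).flow p)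
    · obtain ⟨m, E, r, π, hE, hr, hcode, hπ⟩ := hξ₁
      obtain ⟨η, hη, hag⟩ := exists_agree_hasMarkovLift hd ξ₁ hE₂ hp hE hr hcode
        (π := fun i => (finProdFinEquiv.symm (π i)).1) (by rw [hqc, hπ]; rfl) hrange F
      refine ⟨η, hF η fun g hg z => ?_, .inr hη⟩
      rw [← hsplit _ _ (hag₁ g hg z)]
      refine hsplit _ _ ?_
      rw [hπ]
      exact congrArg π (hag g hg z)
    · exact ⟨ξ₁, hξ₁O, .inl ⟨hqc ▸ hξ₁.of_comp _, hrange⟩⟩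
  · rintro ξ (h | h) hrange
    · exact absurd hrange h.2
    · exact h

/-- The properties of a generic minimal action that characterize the Fraïssé limit: every
partition has a refinement whose itineraries form a minimal nearest-neighbour shift, and every
factor map onto the space of itineraries of a partition lifts. -/
def IsGenericAction (ξ : MinCantorAction (FreeGroup (Fin d))) : Prop :=
  (∀ (n : ℕ) (q : CantorΩ → Fin n), Continuous q → HasMarkovRefinement ξ q) ∧
    ∀ (n m : ℕ) (q : CantorΩ → Fin n) (E : Letter d → Fin m → Fin m → Prop) (hE : IsMinMarkov E)
      (p : markov E → Fin n), Continuous q → Continuous p →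
        range (code ξ.1 q) = range (code (markovSubshift E hE.1).flow p) →
          ∃ ψ : CantorΩ → (markovSubshift E hE.1).carrier, Continuous ψ ∧
            (∀ g z, ψ (ξ.1 g z) = (markovSubshift E hE.1).flow g (ψ z)) ∧ q = p ∘ ψ

theorem HasMarkovLift.exists_map {ξ : MinCantorAction (FreeGroup (Fin d))} {n m : ℕ}
    {q : CantorΩ → Fin n} {E : Letter d → Fin m → Fin m → Prop} (hE : IsMinMarkov E)
    {p : markov E → Fin n} (h : HasMarkovLift ξ q E p) :
    ∃ ψ : CantorΩ → (markovSubshift E hE.1).carrier, Continuous ψ ∧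
      (∀ g z, ψ (ξ.1 g z) = (markovSubshift E hE.1).flow g (ψ z)) ∧ q = p ∘ ψ := by
  obtain ⟨m', E', r, π, θ, hE', hr, hcode, hq, hθ⟩ := h
  have hmem : ∀ z, code ξ.1 r z ∈ markov E' := fun z => hcode ▸ mem_range_self z
  refine ⟨fun z => ⟨θ ∘ code ξ.1 r z, (hθ _ (hmem z)).1⟩, ?_, fun g z => ?_, ?_⟩
  · exact Continuous.subtype_mk (continuous_pi fun g =>
      (continuous_of_discreteTopology (f := θ)).comp
        ((continuous_apply g).comp (continuous_code ξ.1 r hr))) _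
  · refine Subtype.ext ?_
    simp only [code_apply, coe_subshift_flow_apply]
    rfl
  · funext z
    have := (hθ _ (hmem z)).2
    rw [code_one] at this
    rw [hq]
    exact this.symm

theorem residual_isGenericAction (hd : 1 ≤ d) :
    {ξ : MinCantorAction (FreeGroup (Fin d)) | IsGenericAction ξ} ∈
      residual (MinCantorAction (FreeGroup (Fin d))) := by
  have h1 : ∀ᶠ ξ in residual (MinCantorAction (FreeGroup (Fin d))), ∀ (n : ℕ)
      (q : {q : CantorΩ → Fin n // Continuous q}), HasMarkovRefinement ξ q.1 := by
    refine eventually_countable_forall.2 fun n => ?_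
    have := countable_continuous_fin (Z := CantorΩ) n
    refine eventually_countable_forall.2 fun q => ?_
    refine residual_of_dense_open (isOpen_hasMarkovRefinement q.1) ?_
    refine dense_iff_inter_open.2 fun O hO ⟨ξ, hξ⟩ => ?_
    obtain ⟨F, n', q', hq', hF⟩ := exists_agree_subset hO hξ
    let q'' : CantorΩ → Fin (n * n') := fun z => finProdFinEquiv (q.1 z, q' z)
    have hq'' : Continuous q'' :=
      (continuous_of_discreteTopology (f := finProdFinEquiv)).comp (q.2.prodMk hq')
    obtain ⟨ξ₁, hξ₁, hag₁⟩ := exists_agree_hasMarkovRefinement hd ξ hq'' F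
    have hqc : q.1 = (fun i => (finProdFinEquiv.symm i).1) ∘ q'' := by
      funext z
      exact (congrArg Prod.fst (finProdFinEquiv.symm_apply_apply (q.1 z, q' z))).symm
    refine ⟨ξ₁, hF ξ₁ fun g hg z => congrArg Prod.snd (finProdFinEquiv.injective (hag₁ g hg z)),
      ?_⟩
    rw [mem_ofPred_eq, hqc]
    exact hξ₁.of_comp _
  have h2 : ∀ᶠ ξ in residual (MinCantorAction (FreeGroup (Fin d))), ∀ (n m : ℕ)
      (q : {q : CantorΩ → Fin n // Continuous q}) (E : Letter d → Fin m → Fin m → Prop)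
      (hE : IsMinMarkov E) (p : {p : (markovSubshift E hE.1).carrier → Fin n // Continuous p}),
        range (code ξ.1 q.1) = range (code (markovSubshift E hE.1).flow p.1) →
          HasMarkovLift ξ q.1 E p.1 := by
    refine eventually_countable_forall.2 fun n => eventually_countable_forall.2 fun m => ?_
    have := countable_continuous_fin (Z := CantorΩ) n
    refine eventually_countable_forall.2 fun q => eventually_countable_forall.2 fun E =>
      eventually_countable_forall.2 fun hE => ?_
    have := countable_continuous_fin (Z := (markovSubshift E hE.1).carrier) n
    exact eventually_countable_forall.2 fun p => residual_imp_hasMarkovLift hd q.2 hE p.2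
  filter_upwards [h1, h2] with ξ h1 h2
  refine ⟨fun n q hq => h1 n ⟨q, hq⟩, fun n m q E hE p hq hp hrange => ?_⟩
  exact HasMarkovLift.exists_map hE (h2 n m ⟨q, hq⟩ E hE ⟨p, hp⟩ hrange)

end Generic

/-! ### Stone duality for flows -/

open FirstOrder.Language

section Duality

variable {G Z W : Type} [Group G] [TopologicalSpace Z] [TopologicalSpace W]

/-- An element of the algebra of a flow, as a clopen set. -/
def toClopens {ρ : GFlow G Z} (U : ClopenAlg ρ) : Clopens Z := U

/-- A clopen set, as an element of the algebra of a flow. -/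
def ofClopens (ρ : GFlow G Z) (U : Clopens Z) : ClopenAlg ρ := U

@[simp] theorem ofClopens_toClopens {ρ : GFlow G Z} (U : ClopenAlg ρ) :
    ofClopens ρ (toClopens U) = U := rfl

/-- The dual of a factor map: the embedding of algebras of clopen sets given by preimages. -/
def dualEmbedding {ρ : GFlow G Z} {σ : GFlow G W} (φ : W → Z) (hφ : Continuous φ)
    (hsurj : Function.Surjective φ) (heq : ∀ g w, φ (σ g w) = ρ g (φ w)) :
    ClopenAlg ρ ↪[boolActLang G] ClopenAlg σ where
  toFun U := ofClopens σ ⟨φ ⁻¹' toClopens U, (toClopens U).isClopen.preimage hφ⟩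
  inj' U V h := Clopens.ext (hsurj.preimage_injective
    (congrArg (fun U : Clopens W => (U : Set W)) h))
  map_fun' f v := by
    cases f with
    | bot => rfl
    | top => rfl
    | inf => rfl
    | sup => rfl
    | compl => rfl
    | act g =>
      refine Clopens.ext ?_
      change φ ⁻¹' (ρ g '' toClopens (v 0)) = σ g '' (φ ⁻¹' toClopens (v 0))
      ext w
      constructor
      · rintro ⟨z, hz, hzw⟩
        refine ⟨σ g⁻¹ w, ?_, by simp⟩
        rw [mem_preimage, heq, ← hzw]
        simpa using hz
      · rintro ⟨y, hy, rfl⟩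
        exact ⟨φ y, hy, (heq g y).symm⟩
  map_rel' r := r.elim

theorem mem_dualEmbedding {ρ : GFlow G Z} {σ : GFlow G W} {φ : W → Z} {hφ : Continuous φ}
    {hsurj : Function.Surjective φ} {heq : ∀ g w, φ (σ g w) = ρ g (φ w)} (U : ClopenAlg ρ)
    (w : W) : w ∈ toClopens (dualEmbedding φ hφ hsurj heq U) ↔ φ w ∈ toClopens U := Iff.rfl

/-- **Stone duality**: an embedding of algebras of clopen sets is induced by a factor map. -/
theorem exists_eq_dualEmbedding [CompactSpace Z] [T2Space Z] [TotallyDisconnectedSpace Z]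
    [CompactSpace W] {ρ : GFlow G Z} {σ : GFlow G W}
    (f : ClopenAlg ρ ↪[boolActLang G] ClopenAlg σ) :
    ∃ (φ : W → Z) (hφ : Continuous φ) (hsurj : Function.Surjective φ)
      (heq : ∀ g w, φ (σ g w) = ρ g (φ w)), f = dualEmbedding φ hφ hsurj heq := by
  let f' : Clopens Z → Clopens W := f
  have hbot : f' ⊥ = ⊥ := f.map_fun (BoolActFunc.bot : (boolActLang G).Functions 0) ![]
  have hinf : ∀ U V, f' (U ⊓ V) = f' U ⊓ f' V := fun U V =>
    f.map_fun (BoolActFunc.inf : (boolActLang G).Functions 2)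
      (![U, V] : Fin 2 → Clopens Z)
  have hcompl : ∀ U, f' Uᶜ = (f' U)ᶜ := fun U =>
    f.map_fun (BoolActFunc.compl : (boolActLang G).Functions 1) (![U] : Fin 1 → Clopens Z)
  have hact : ∀ g U, f' (clopenTranslate ρ g U) = clopenTranslate σ g (f' U) := fun g U =>
    f.map_fun (BoolActFunc.act g : (boolActLang G).Functions 1) (![U] : Fin 1 → Clopens Z)
  have hinj : Function.Injective f' := f.injective
  have hempty : ∀ U : Clopens Z, ¬ (U : Set Z).Nonempty → U = ⊥ := fun U hU =>
    Clopens.ext (not_nonempty_iff_eq_empty.1 hU)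
  have hpt : ∀ w, ∃ z, ∀ U : Clopens Z, w ∈ f' U ↔ z ∈ U := by
    intro w
    let S : Set (Set Z) := {s | ∃ U : Clopens Z, w ∈ f' U ∧ (U : Set Z) = s}
    have hS : Nonempty S := ⟨⟨_, ⊥ᶜ, by
      rw [hcompl, hbot]
      exact fun h => h, rfl⟩⟩
    obtain ⟨z, hz⟩ := IsCompact.nonempty_sInter_of_directed_nonempty_isCompact_isClosed (S := S)
      (by
        rintro _ ⟨U, hU, rfl⟩ _ ⟨V, hV, rfl⟩
        exact ⟨_, ⟨U ⊓ V, by rw [hinf]; exact ⟨hU, hV⟩, rfl⟩, inter_subset_left,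
          inter_subset_right⟩)
      (by
        rintro _ ⟨U, hU, rfl⟩
        by_contra h
        rw [hempty U h, hbot] at hU
        exact hU)
      (by
        rintro _ ⟨U, hU, rfl⟩
        exact U.isClopen.isClosed.isCompact)
      (by
        rintro _ ⟨U, hU, rfl⟩
        exact U.isClopen.isClosed)
    refine ⟨z, fun U => ⟨fun h => hz _ ⟨U, h, rfl⟩, fun h => ?_⟩⟩
    by_contra hw
    have : w ∈ f' Uᶜ := by rw [hcompl]; exact hw
    exact hz _ ⟨Uᶜ, this, rfl⟩ h
  choose φ hφ using hpt
  have hsep : ∀ z z' : Z, (∀ U : Clopens Z, z ∈ U → z' ∈ U) → z = z' := by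
    intro z z' h
    by_contra hne
    obtain ⟨U, hU, hz, hz'⟩ := exists_isClopen_of_totally_separated hne
    exact hz' (h ⟨U, hU⟩ hz)
  have hcont : Continuous φ := by
    have hbasis : IsTopologicalBasis {s : Set Z | IsClopen s} := isTopologicalBasis_isClopen
    refine hbasis.continuous_iff.2 fun U hU => ?_
    have : φ ⁻¹' U = f' ⟨U, hU⟩ := by
      ext w
      exact (hφ w ⟨U, hU⟩).symm
    rw [this]
    exact (f' ⟨U, hU⟩).isClopen.isOpen
  refine ⟨φ, hcont, ?_, fun g w => hsep _ _ fun U hU => ?_, ?_⟩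
  · by_contra hns
    simp only [Function.Surjective, not_forall] at hns
    obtain ⟨z, hz⟩ := hns
    obtain ⟨V, hV, hzV, hVr⟩ := compact_exists_isClopen_in_isOpen
      (isCompact_range hcont).isClosed.isOpen_compl (show z ∈ (range φ)ᶜ from hz)
    have : f' ⟨V, hV⟩ = f' ⊥ := by
      rw [hbot]
      refine Clopens.ext (not_nonempty_iff_eq_empty.1 ?_)
      rintro ⟨w, hw⟩
      exact hVr ((hφ w ⟨V, hV⟩).1 hw) ⟨w, rfl⟩
    have h1 := hinj this
    have : z ∈ (⟨V, hV⟩ : Clopens Z) := hzV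
    rw [h1] at this
    exact this
  · have h1 : σ g w ∈ f' U := (hφ _ U).2 hU
    have h2 : w ∈ f' (clopenTranslate ρ g⁻¹ U) := by
      rw [hact]
      exact ⟨σ g w, h1, by simp⟩
    obtain ⟨u, hu, huw⟩ := (hφ w _).1 h2
    rw [← huw]
    simpa using hu
  · ext1 U
    exact Clopens.ext (Set.ext fun w => hφ w (toClopens U))

/-- A subalgebra of the clopen sets of a compact space that separates the points contains all
the clopen sets. -/
theorem eq_top_of_separates [CompactSpace Z] {ρ : GFlow G Z}
    (T : (boolActLang G).Substructure (ClopenAlg ρ))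
    (hT : ∀ x y : Z, x ≠ y → ∃ U : Clopens Z, ofClopens ρ U ∈ T ∧ x ∈ U ∧ y ∉ U) :
    T = ⊤ := by
  let T' : Set (Clopens Z) := {U | ofClopens ρ U ∈ T}
  have hbot : (⊥ : Clopens Z) ∈ T' :=
    T.fun_mem (BoolActFunc.bot : (boolActLang G).Functions 0) ![] (fun i => i.elim0)
  have htop : (⊤ : Clopens Z) ∈ T' :=
    T.fun_mem (BoolActFunc.top : (boolActLang G).Functions 0) ![] (fun i => i.elim0)
  have hinf : ∀ U ∈ T', ∀ V ∈ T', U ⊓ V ∈ T' := fun U hU V hV =>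
    T.fun_mem (BoolActFunc.inf : (boolActLang G).Functions 2) (![U, V] : Fin 2 → Clopens Z)
      (fun i => by fin_cases i; exacts [hU, hV])
  have hsup : ∀ U ∈ T', ∀ V ∈ T', U ⊔ V ∈ T' := fun U hU V hV =>
    T.fun_mem (BoolActFunc.sup : (boolActLang G).Functions 2) (![U, V] : Fin 2 → Clopens Z)
      (fun i => by fin_cases i; exacts [hU, hV])
  rw [eq_top_iff]
  intro U _
  let U' : Clopens Z := U
  have h1 : ∀ x ∈ U', ∃ V ∈ T', x ∈ V ∧ V ≤ U' := by
    intro x hx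
    obtain ⟨V, hV, hxV, hd⟩ := (U'.isClopen.compl.isClosed.isCompact).induction_on
      (p := fun s => ∃ V ∈ T', x ∈ V ∧ Disjoint (V : Set Z) s)
      ⟨⊤, htop, trivial, disjoint_empty _⟩
      (fun s t hst ⟨V, hV, hx, h⟩ => ⟨V, hV, hx, h.mono_right hst⟩)
      (fun s t ⟨V, hV, hx, h⟩ ⟨V', hV', hx', h'⟩ => ⟨V ⊓ V', hinf _ hV _ hV', ⟨hx, hx'⟩,
        disjoint_union_right.2 ⟨h.mono_left inter_subset_left, h'.mono_left inter_subset_right⟩⟩)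
      (fun y hy => by
        have hxy : x ≠ y := fun h => hy (h ▸ hx)
        obtain ⟨V, hV, hxV, hyV⟩ := hT x y hxy
        exact ⟨(V : Set Z)ᶜ, mem_nhdsWithin_of_mem_nhds (V.isClopen.compl.isOpen.mem_nhds hyV),
          V, hV, hxV, disjoint_compl_right⟩)
    exact ⟨V, hV, hxV, fun y hy => by_contra fun hyU => disjoint_left.1 hd hy hyU⟩
  obtain ⟨V, hV, hUV, hVU⟩ := (U'.isClopen.isClosed.isCompact).induction_on
    (p := fun s => ∃ V ∈ T', s ⊆ V ∧ V ≤ U')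
    ⟨⊥, hbot, empty_subset _, bot_le⟩
    (fun s t hst ⟨V, hV, h, h'⟩ => ⟨V, hV, hst.trans h, h'⟩)
    (fun s t ⟨V, hV, h, h'⟩ ⟨V₂, hV₂, h₂, h₂'⟩ =>
      ⟨V ⊔ V₂, hsup _ hV _ hV₂, union_subset_union h h₂, sup_le h' h₂'⟩)
    (fun x hx => by
      obtain ⟨V, hV, hxV, hVU⟩ := h1 x hx
      exact ⟨V, mem_nhdsWithin_of_mem_nhds (V.isClopen.isOpen.mem_nhds hxV), V, hV,
        subset_rfl, hVU⟩)
  have : V = U' := le_antisymm hVU hUV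
  rw [this] at hV
  exact hV

/-- The algebra of a subshift is generated by any family of clopen sets that determines the
symbol at the identity. -/
theorem closure_eq_top_of_separates {A : Type} [Finite A] [TopologicalSpace A]
    (X : Subshift G A) (S : Set (ClopenAlg X.flow))
    (hS : ∀ x y : X.carrier, x.1 1 ≠ y.1 1 →
      ∃ U : Clopens X.carrier, ofClopens X.flow U ∈ S ∧ (x ∈ U ↔ y ∉ U)) :
    Substructure.closure (boolActLang G) S = ⊤ := by
  refine eq_top_of_separates _ fun x y hxy => ?_
  have hne : x.1 ≠ y.1 := fun h => hxy (Subtype.ext h)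
  obtain ⟨g, hg⟩ := Function.ne_iff.1 hne
  obtain ⟨U, hU, hxU⟩ := hS (X.flow g⁻¹ x) (X.flow g⁻¹ y) (by
    simpa only [coe_subshift_flow_apply, shift_apply, inv_inv, mul_one] using hg)
  have hU' := Substructure.subset_closure (L := boolActLang G) hU
  have hact : ∀ V : Clopens X.carrier, ofClopens X.flow V ∈
      Substructure.closure (boolActLang G) S →
      ofClopens X.flow (clopenTranslate X.flow g V) ∈ Substructure.closure (boolActLang G) S :=
    fun V hV =>
    Substructure.fun_mem _ (BoolActFunc.act g : (boolActLang G).Functions 1)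
      ![ofClopens X.flow V] (fun i => by fin_cases i; exact hV)
  have hmem : ∀ (V : Clopens X.carrier) (z : X.carrier),
      z ∈ clopenTranslate X.flow g V ↔ X.flow g⁻¹ z ∈ V := by
    intro V z
    constructor
    · rintro ⟨v, hv, rfl⟩
      simpa using hv
    · intro h
      exact ⟨_, h, by simp⟩
  by_cases hx : X.flow g⁻¹ x ∈ U
  · exact ⟨_, hact U hU', (hmem _ _).2 hx, fun h => hxU.1 hx ((hmem _ _).1 h)⟩
  · have hy : X.flow g⁻¹ y ∈ U := by
      by_contra h
      exact hx (hxU.2 h)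
    have hUc : ofClopens X.flow (Uᶜ) ∈ Substructure.closure (boolActLang G) S :=
      Substructure.fun_mem _ (BoolActFunc.compl : (boolActLang G).Functions 1)
        ![ofClopens X.flow U] (fun i => by fin_cases i; exact hU')
    exact ⟨_, hact Uᶜ hUc, (hmem _ _).2 hx, fun h => (hmem _ _).1 h hy⟩

/-- The algebra of clopen sets of a subshift is finitely generated. -/
theorem fg_clopenAlg_subshift {A : Type} [Finite A] [TopologicalSpace A] [DiscreteTopology A]
    (X : Subshift G A) : Structure.FG (boolActLang G) (ClopenAlg X.flow) := by
  have hcont : Continuous fun x : X.carrier => x.1 1 :=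
    (continuous_apply 1).comp continuous_subtype_val
  let S : Set (ClopenAlg X.flow) := range fun a : A =>
    (⟨(fun x : X.carrier => x.1 1) ⁻¹' {a}, isClopen_fibre hcont _⟩ : Clopens X.carrier)
  refine ⟨Substructure.fg_def.2 ⟨S, finite_range _, ?_⟩⟩
  refine closure_eq_top_of_separates X S fun x y hxy => ⟨_, ⟨x.1 1, rfl⟩, ?_⟩
  exact iff_of_true rfl fun h => hxy h.symm

/-- The subshift of the itineraries of a flow with respect to a clopen partition. -/
def codeSubshift [CompactSpace Z] [Nonempty Z] {A : Type} [TopologicalSpace A]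
    [DiscreteTopology A] (ρ : GFlow G Z) (q : Z → A) (hq : Continuous q) : Subshift G A where
  carrier := range (code ρ q)
  nonempty' := range_nonempty _
  isClosed' := (isCompact_range (continuous_code ρ q hq)).isClosed
  invariant' := by
    rintro g _ ⟨z, rfl⟩
    exact ⟨ρ g z, code_apply ρ q z g⟩

/-- The embedding dual to the itinerary map. -/
def codeEmbedding [CompactSpace Z] [Nonempty Z] {A : Type} [TopologicalSpace A]
    [DiscreteTopology A] (ρ : GFlow G Z) (q : Z → A) (hq : Continuous q) :
    ClopenAlg (codeSubshift ρ q hq).flow ↪[boolActLang G] ClopenAlg ρ :=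
  dualEmbedding (fun z => ⟨code ρ q z, z, rfl⟩) ((continuous_code ρ q hq).subtype_mk _)
    (by rintro ⟨_, z, rfl⟩; exact ⟨z, rfl⟩) (fun g z => Subtype.ext (code_apply ρ q z g))

/-- Every finitely generated subalgebra of the algebra of a flow is dual to the space of
itineraries with respect to some clopen partition. -/
theorem exists_range_codeEmbedding_eq [CompactSpace Z] [Nonempty Z] (ρ : GFlow G Z)
    (S : (boolActLang G).Substructure (ClopenAlg ρ)) (hS : S.FG) :
    ∃ (n : ℕ) (q : Z → Fin n) (hq : Continuous q), (codeEmbedding ρ q hq).toHom.range = S := by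
  classical
  obtain ⟨s, rfl⟩ := hS
  obtain ⟨n, ⟨e⟩⟩ := Finite.exists_equiv_fin (s → Bool)
  let q : Z → Fin n := fun z => e fun U => decide (z ∈ toClopens U.1)
  have hq : Continuous q := by
    refine (continuous_of_discreteTopology (f := e)).comp (continuous_pi fun U => ?_)
    refine continuous_discrete_rng.2 ?_
    rintro (_ | _)
    · convert (toClopens U.1).isClopen.compl.isOpen using 1
      ext x; simp
    · convert (toClopens U.1).isClopen.isOpen using 1
      ext x; simp
  let X := codeSubshift ρ q hq
  have hcont : Continuous fun x : X.carrier => x.1 1 :=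
    (continuous_apply 1).comp continuous_subtype_val
  let gen : s → Clopens X.carrier := fun U =>
    ⟨(fun x : X.carrier => x.1 1) ⁻¹' {a | e.symm a U = true}, isClopen_fibre hcont _⟩
  have htop : Substructure.closure (boolActLang G) (range gen : Set (ClopenAlg X.flow)) = ⊤ := by
    refine closure_eq_top_of_separates X _ fun x y hxy => ?_
    obtain ⟨U, hU⟩ := Function.ne_iff.1 fun h => hxy (e.symm.injective h)
    refine ⟨gen U, ⟨U, rfl⟩, ?_⟩
    change e.symm (x.1 1) U = true ↔ ¬ e.symm (y.1 1) U = true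
    revert hU
    cases e.symm (x.1 1) U <;> cases e.symm (y.1 1) U <;> simp
  have himage : (codeEmbedding ρ q hq).toHom '' (range gen : Set (ClopenAlg X.flow)) =
      (s : Set (ClopenAlg ρ)) := by
    have hgen : ∀ U, (codeEmbedding ρ q hq).toHom (ofClopens X.flow (gen U)) = U.1 := by
      intro U
      refine Clopens.ext (Set.ext fun z => ?_)
      rw [← ofClopens_toClopens U.1]
      change e.symm (code ρ q z 1) U = true ↔ z ∈ toClopens U.1
      simp [q]
    ext V
    constructor
    · rintro ⟨_, ⟨U, rfl⟩, rfl⟩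
      have := hgen U
      exact this ▸ U.2
    · intro hV
      exact ⟨_, ⟨⟨V, hV⟩, rfl⟩, hgen _⟩
  refine ⟨n, q, hq, ?_⟩
  rw [Hom.range_eq_map, ← htop, ← himage]
  exact (Substructure.closure_image _).symm

end Duality

/-! ### The Fraïssé limit -/

section Limit

variable {d : ℕ}

/-- A subshift of finite type over a free group contains an image of a minimal nearest-neighbour
shift. -/
theorem exists_map_of_isSFT (hd : 1 ≤ d) {B : Type} [Finite B] [TopologicalSpace B]
    [DiscreteTopology B] {Y : Subshift (FreeGroup (Fin d)) B} (hY : Y.IsSFT) :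
    ∃ (m : ℕ) (E : Letter d → Fin m → Fin m → Prop) (hE : IsMinMarkov E)
      (φ : (markovSubshift E hE.1).carrier → Y.carrier), Continuous φ ∧
        ∀ g w, φ ((markovSubshift E hE.1).flow g w) = Y.flow g (φ w) := by
  classical
  obtain ⟨P, hP, hYP⟩ := hY
  have hmem : ∀ x, x ∈ Y.carrier ↔ ∀ g, ∀ p ∈ P, shift g x ∉ cylinder p := by
    intro x
    rw [hYP]
    simp only [mem_compl_iff, mem_iUnion, not_exists]
    constructor
    · intro h g p hp hx
      exact h p hp g⁻¹ ⟨_, hx, by simp⟩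
    · rintro h p hp g ⟨y, hy, rfl⟩
      exact h g⁻¹ p hp (by simpa using hy)
  obtain ⟨y, hy⟩ := Y.nonempty'
  obtain ⟨m, E, κ, hE, hκ⟩ := exists_isMinMarkov_map hd (fun _ _ _ => True)
    {x : FreeGroup (Fin d) → B | ∀ p ∈ P, x ∉ cylinder p} (hP.toFinset.biUnion Sigma.fst)
    (by
      intro x _ x' _ hxx' hx p hp hx'
      refine hx p hp fun h => ?_
      rw [hxx' h (Finset.mem_biUnion.2 ⟨p, hP.mem_toFinset.2 hp, h.2⟩)]
      exact hx' h)
    ⟨y, fun _ _ => trivial, (hmem y).1 hy⟩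
  refine ⟨m, E, hE, fun w => ⟨κ ∘ w.1, (hmem _).2 fun g p hp => ?_⟩, ?_, fun g w => rfl⟩
  · exact (hκ (shift g w.1) (shift_mem_markov E g w.2)).2 p hp
  · exact Continuous.subtype_mk (continuous_pi fun g =>
      (continuous_of_discreteTopology (f := κ)).comp
        ((continuous_apply g).comp continuous_subtype_val)) _

/-- The itineraries of a generic action form a sofic subshift. -/
theorem IsGenericAction.isSofic {ξ : MinCantorAction (FreeGroup (Fin d))}
    (hξ : IsGenericAction ξ) {n : ℕ} {q : CantorΩ → Fin n} (hq : Continuous q) :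
    (codeSubshift ξ.1 q hq).IsSofic := by
  obtain ⟨m, E, r, π, hE, hr, hcode, hπ⟩ := hξ.1 n q hq
  have hmem : ∀ z, code ξ.1 r z ∈ markov E := fun z => hcode ▸ mem_range_self z
  have hmem' : ∀ w ∈ markov E, ∃ z, code ξ.1 r z = w := fun w hw => by
    rw [← hcode] at hw
    exact hw
  have hcomp : ∀ z, (fun g => π (code ξ.1 r z g)) = code ξ.1 q z := by
    intro z
    rw [hπ]
    rfl
  refine ⟨Fin m, inferInstance, inferInstance, inferInstance, markovSubshift E hE.1,
    markovSubshift_isSFT E hE.1, fun w => ⟨fun g => π (w.1 g), ?_⟩, ?_, ?_, fun g w => rfl⟩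
  · obtain ⟨z, hz⟩ := hmem' w.1 w.2
    exact ⟨z, by rw [← hz, hcomp]⟩
  · exact Continuous.subtype_mk (continuous_pi fun g =>
      (continuous_of_discreteTopology (f := π)).comp
        ((continuous_apply g).comp continuous_subtype_val)) _
  · rintro ⟨_, z, rfl⟩
    exact ⟨⟨code ξ.1 r z, hmem z⟩, Subtype.ext (hcomp z)⟩

theorem IsGenericAction.age_eq (hd : 1 ≤ d) {ξ : MinCantorAction (FreeGroup (Fin d))}
    (hξ : IsGenericAction ξ) :
    (boolActLang (FreeGroup (Fin d))).age (ClopenAlg ξ.1) =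
      soficMinimalClass (FreeGroup (Fin d)) := by
  ext N
  constructor
  · rintro ⟨hN, ⟨f⟩⟩
    obtain ⟨n, q, hq, hS⟩ := exists_range_codeEmbedding_eq ξ.1 f.toHom.range (hN.range f.toHom)
    refine ⟨Fin n, inferInstance, inferInstance, inferInstance, codeSubshift ξ.1 q hq,
      hξ.isSofic hq, ?_, ⟨?_⟩⟩
    · exact ξ.2.of_factor (φ := fun z => (⟨code ξ.1 q z, z, rfl⟩ : (codeSubshift ξ.1 q hq).carrier))
        ((continuous_code ξ.1 q hq).subtype_mk _) (by rintro ⟨_, z, rfl⟩; exact ⟨z, rfl⟩)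
        (fun g z => Subtype.ext (code_apply ξ.1 q z g))
    · have e := (codeEmbedding ξ.1 q hq).equivRange
      rw [hS] at e
      exact e.symm.comp f.equivRange
  · rintro ⟨A, _, _, _, X, ⟨B, _, _, _, Y, hY, φ, hφ, hφs, hφe⟩, hmin, ⟨e⟩⟩
    obtain ⟨m, E, hE, θ, hθ, hθe⟩ := exists_map_of_isSFT hd hY
    -- A trivial partition has trivial itineraries, so the shift `markov E` is a factor of `ξ`.
    have hrange : range (code ξ.1 fun _ => (0 : Fin 1)) =
        range (code (markovSubshift E hE.1).flow fun _ => (0 : Fin 1)) := by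
      have h1 : ∀ {Z : Type} [TopologicalSpace Z] (ρ : GFlow (FreeGroup (Fin d)) Z),
          code ρ (fun _ => (0 : Fin 1)) = fun _ _ => 0 := fun ρ => rfl
      rw [h1, h1, range_const, range_const]
    obtain ⟨ψ, hψ, hψe, -⟩ := hξ.2 1 m _ E hE _ continuous_const continuous_const hrange
    have hc : Continuous fun z => φ (θ (ψ z)) := hφ.comp (hθ.comp hψ)
    have he : ∀ g z, φ (θ (ψ (ξ.1 g z))) = X.flow g (φ (θ (ψ z))) := fun g z => by
      rw [hψe, hθe, hφe]
    exact ⟨e.fg_iff.2 (fg_clopenAlg_subshift X),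
      ⟨(dualEmbedding _ hc (hmin.surjective hc he) he).comp e.toEmbedding⟩⟩

theorem IsGenericAction.isExtensionPair {ξ : MinCantorAction (FreeGroup (Fin d))}
    (hξ : IsGenericAction ξ) :
    (boolActLang (FreeGroup (Fin d))).IsExtensionPair (ClopenAlg ξ.1) (ClopenAlg ξ.1) := by
  classical
  refine isExtensionPair_iff_exists_embedding_closure_singleton_sup.2 fun S hS f m => ?_
  obtain ⟨n, q, hq, rfl⟩ := exists_range_codeEmbedding_eq ξ.1 S hS
  -- The embedding `f` is dual to a second factor map `φ₁` onto the space of itineraries.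
  obtain ⟨φ₁, hφ₁, hφ₁s, hφ₁e, hf⟩ :=
    exists_eq_dualEmbedding (f.comp (codeEmbedding ξ.1 q hq).equivRange.toEmbedding)
  have hU : Continuous fun z => decide (z ∈ toClopens m) := by
    refine continuous_discrete_rng.2 ?_
    rintro (_ | _)
    · convert (toClopens m).isClopen.compl.isOpen using 1
      ext x; simp
    · convert (toClopens m).isClopen.isOpen using 1
      ext x; simp
  obtain ⟨k, ⟨e⟩⟩ := Finite.exists_equiv_fin (Fin n × Bool)
  obtain ⟨m', E, r, π, hE, hr, hcode, hπ⟩ := hξ.1 k (fun z => e (q z, decide (z ∈ toClopens m)))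
    ((continuous_of_discreteTopology (f := e)).comp (hq.prodMk hU))
  have hπ' : ∀ z, e.symm (π (r z)) = (q z, decide (z ∈ toClopens m)) := by
    intro z
    rw [Equiv.symm_apply_eq]
    exact (congrFun hπ z).symm
  have hmem : ∀ z, code ξ.1 r z ∈ markov E := fun z => hcode ▸ mem_range_self z
  have hmem' : ∀ w ∈ markov E, ∃ z, code ξ.1 r z = w := fun w hw => by
    rw [← hcode] at hw
    exact hw
  let V := markovSubshift E hE.1
  let φ : CantorΩ → V.carrier := fun z => ⟨code ξ.1 r z, hmem z⟩
  have hφ : Continuous φ := (continuous_code ξ.1 r hr).subtype_mk _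
  have hφe : ∀ g z, φ (ξ.1 g z) = V.flow g (φ z) := fun g z =>
    Subtype.ext (code_apply ξ.1 r z g)
  have hφs : Function.Surjective φ := hE.isMinimal.surjective hφ hφe
  let ι := dualEmbedding φ hφ hφs hφe
  -- The factor map from `V` to the space of itineraries with respect to `q`.
  let χ₀ : (FreeGroup (Fin d) → Fin m') → FreeGroup (Fin d) → Fin n :=
    fun x g => (e.symm (π (x g))).1
  have hχφ : ∀ z, χ₀ (code ξ.1 r z) = code ξ.1 q z := by
    intro z
    funext g
    simp only [χ₀, code, hπ']
  let X := codeSubshift ξ.1 q hq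
  let χ : V.carrier → X.carrier := fun v => ⟨χ₀ v.1, by
    obtain ⟨z, hz⟩ := hmem' v.1 v.2
    exact ⟨z, by rw [← hz, hχφ]⟩⟩
  have hχ : Continuous χ := Continuous.subtype_mk (continuous_pi fun g =>
    (continuous_of_discreteTopology (f := fun i => (e.symm (π i)).1)).comp
      ((continuous_apply g).comp continuous_subtype_val)) _
  have hχs : Function.Surjective χ := by
    rintro ⟨_, z, rfl⟩
    exact ⟨φ z, Subtype.ext (hχφ z)⟩
  have hχe : ∀ g v, χ (V.flow g v) = X.flow g (χ v) := fun g v => rfl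
  let χd := dualEmbedding χ hχ hχs hχe
  have hιχ : ∀ u, ι (χd u) = codeEmbedding ξ.1 q hq u := by
    intro u
    refine Clopens.ext (Set.ext fun z => ?_)
    change χ (φ z) ∈ toClopens u ↔ (⟨code ξ.1 q z, z, rfl⟩ : X.carrier) ∈ toClopens u
    rw [show χ (φ z) = ⟨code ξ.1 q z, z, rfl⟩ from Subtype.ext (hχφ z)]
  -- The second factor map lifts to `V`.
  let p : V.carrier → Fin n := fun v => (χ v).1 1
  have hp : Continuous p := (continuous_apply 1).comp (continuous_subtype_val.comp hχ)
  have hcodep : ∀ v, code V.flow p v = (χ v).1 := by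
    intro v
    funext g
    change (χ (V.flow g⁻¹ v)).1 1 = _
    rw [hχe, coe_subshift_flow_apply, shift_apply, inv_inv, mul_one]
  have hcode₁ : ∀ z, code ξ.1 (fun z => (φ₁ z).1 1) z = (φ₁ z).1 := by
    intro z
    funext g
    change (φ₁ (ξ.1 g⁻¹ z)).1 1 = _
    rw [hφ₁e, coe_subshift_flow_apply, shift_apply, inv_inv, mul_one]
  have hrange : range (code ξ.1 fun z => (φ₁ z).1 1) = range (code V.flow p) := by
    have h1 : code ξ.1 (fun z => (φ₁ z).1 1) = Subtype.val ∘ φ₁ := funext hcode₁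
    have h2 : code V.flow p = Subtype.val ∘ χ := funext hcodep
    rw [h1, h2, hφ₁s.range_comp, hχs.range_comp]
  obtain ⟨ψ, hψ, hψe, hψp⟩ := hξ.2 n m' _ E hE p
    ((continuous_apply 1).comp (continuous_subtype_val.comp hφ₁)) hp hrange
  have hψs : Function.Surjective ψ := hE.isMinimal.surjective hψ hψe
  have hχψ : ∀ z, χ (ψ z) = φ₁ z := by
    intro z
    have h : code V.flow p (ψ z) = code ξ.1 (fun z => (φ₁ z).1 1) z := by
      funext g
      exact (congrArg p (hψe g⁻¹ z)).symm.trans (congrFun hψp (ξ.1 g⁻¹ z)).symm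
    exact Subtype.ext ((hcodep _).symm.trans (h.trans (hcode₁ z)))
  let ψd := dualEmbedding ψ hψ hψs hψe
  have hψχ : ∀ u, ψd (χd u) = f ((codeEmbedding ξ.1 q hq).equivRange u) := by
    intro u
    have : f ((codeEmbedding ξ.1 q hq).equivRange u) = dualEmbedding φ₁ hφ₁ hφ₁s hφ₁e u := by
      rw [← hf]
      rfl
    rw [this]
    refine Clopens.ext (Set.ext fun z => ?_)
    change χ (ψ z) ∈ toClopens u ↔ φ₁ z ∈ toClopens u
    rw [hχψ]
  have hle : Substructure.closure (boolActLang (FreeGroup (Fin d))) {m} ⊔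
      (codeEmbedding ξ.1 q hq).toHom.range ≤ ι.toHom.range := by
    refine sup_le (Substructure.closure_le.2 (singleton_subset_iff.2 ?_)) ?_
    · have hc : Continuous fun v : V.carrier => v.1 1 :=
        (continuous_apply 1).comp continuous_subtype_val
      refine ⟨ofClopens V.flow ⟨(fun v : V.carrier => v.1 1) ⁻¹' {i | (e.symm (π i)).2 = true},
        isClopen_fibre hc _⟩, ?_⟩
      refine Clopens.ext (Set.ext fun z => ?_)
      change (e.symm (π (code ξ.1 r z 1))).2 = true ↔ z ∈ toClopens m
      rw [code_one, hπ']
      simp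
    · rintro _ ⟨u, rfl⟩
      exact ⟨χd u, hιχ u⟩
  refine ⟨ψd.comp (ι.equivRange.symm.toEmbedding.comp (Substructure.inclusion hle)), ?_⟩
  ext ⟨x, u, rfl⟩
  have h1 : ι.equivRange.symm (Substructure.inclusion hle (Substructure.inclusion le_sup_right
      ⟨(codeEmbedding ξ.1 q hq).toHom u, u, rfl⟩)) = χd u := by
    apply ι.equivRange.injective
    rw [FirstOrder.Language.Equiv.apply_symm_apply]
    exact Subtype.ext (hιχ u).symm
  change f _ = ψd (ι.equivRange.symm (Substructure.inclusion hle (Substructure.inclusion _ _)))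
  rw [h1, hψχ]
  rfl

/-- The algebra of a generic action is the Fraïssé limit of the class of sofic minimal
subshifts. -/
theorem IsGenericAction.isFraisseLimit (hd : 1 ≤ d) {ξ : MinCantorAction (FreeGroup (Fin d))}
    (hξ : IsGenericAction ξ) :
    IsFraisseLimit (soficMinimalClass (FreeGroup (Fin d))) (ClopenAlg ξ.1) where
  ultrahomogeneous :=
    (isUltrahomogeneous_iff_IsExtensionPair Structure.cg_of_countable).2 hξ.isExtensionPair
  age := hξ.age_eq hd

/-- Ultrahomogeneity is invariant under isomorphism. -/
theorem _root_.FirstOrder.Language.IsUltrahomogeneous.of_equiv {L : FirstOrder.Language}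
    {M N : Type} [L.Structure M] [L.Structure N] (h : L.IsUltrahomogeneous N) (e : M ≃[L] N) :
    L.IsUltrahomogeneous M := by
  intro S hS f
  let j := e.toEmbedding.comp S.subtype
  obtain ⟨g, hg⟩ := h j.toHom.range
    (((Substructure.fg_iff_structure_fg S).1 hS).range j.toHom)
    ((e.toEmbedding.comp f).comp j.equivRange.symm.toEmbedding)
  refine ⟨e.symm.comp (g.comp e), ?_⟩
  ext x
  have h1 : e (f (j.equivRange.symm (j.equivRange x))) = g (e x) :=
    congrArg (fun k => k (j.equivRange x)) hg
  rw [FirstOrder.Language.Equiv.symm_apply_apply] at h1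
  change f x = e.symm (g (e x))
  rw [← h1, FirstOrder.Language.Equiv.symm_apply_apply]

/-- An isomorphism of the algebras of two Cantor actions is dual to a conjugacy. -/
theorem mem_conjClass_of_equiv {G : Type} [Group G] {ξ η : MinCantorAction G}
    (e : ClopenAlg ξ.1 ≃[boolActLang G] ClopenAlg η.1) : η ∈ conjClass ξ := by
  obtain ⟨φ, hφ, hφs, hφe, he⟩ := exists_eq_dualEmbedding e.toEmbedding
  have hinj : Function.Injective φ := by
    intro z z' h
    by_contra hne
    obtain ⟨U, hU, hz, hz'⟩ := exists_isClopen_of_totally_separated hne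
    obtain ⟨V, hV⟩ := e.surjective (ofClopens η.1 ⟨U, hU⟩)
    have h1 : ∀ y, y ∈ U ↔ φ y ∈ toClopens V := by
      intro y
      have : dualEmbedding φ hφ hφs hφe V = ofClopens η.1 ⟨U, hU⟩ := by
        rw [← hV, ← he]
        rfl
      rw [← mem_dualEmbedding (hφ := hφ) (hsurj := hφs) (heq := hφe), this]
      rfl
    exact hz' ((h1 z').2 (h ▸ (h1 z).1 hz))
  let f : CantorΩ ≃ₜ CantorΩ :=
    Continuous.homeoOfEquivCompactToT2 (f := Equiv.ofBijective φ ⟨hinj, hφs⟩) hφ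
  have hf : ∀ z, f z = φ z := fun _ => rfl
  refine ⟨f.symm, fun g => Homeomorph.ext fun z => ?_⟩
  change η.1 g z = f.symm (ξ.1 g (f z))
  rw [Homeomorph.eq_symm_apply, hf, hf, hφe]

/-- Conjugate actions have isomorphic algebras. -/
theorem nonempty_equiv_of_mem_conjClass {G : Type} [Group G] {ξ η : MinCantorAction G}
    (h : η ∈ conjClass ξ) : Nonempty (ClopenAlg η.1 ≃[boolActLang G] ClopenAlg ξ.1) := by
  obtain ⟨f, hf⟩ := h
  have heq : ∀ g z, f (ξ.1 g z) = η.1 g (f z) := by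
    intro g z
    rw [hf]
    exact (congrArg (fun y => f (ξ.1 g y)) (f.symm_apply_apply z)).symm
  have heq' : ∀ g z, f.symm (η.1 g z) = ξ.1 g (f.symm z) := by
    intro g z
    rw [Homeomorph.symm_apply_eq, heq, Homeomorph.apply_symm_apply]
  let F := dualEmbedding (ρ := η.1) (σ := ξ.1) f f.continuous f.surjective heq
  let F' := dualEmbedding (ρ := ξ.1) (σ := η.1) f.symm f.symm.continuous f.symm.surjective heq'
  refine ⟨⟨⟨F, F', fun U => ?_, fun U => ?_⟩, F.map_fun', F.map_rel'⟩⟩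
  · refine Clopens.ext (Set.ext fun z => ?_)
    change f (f.symm z) ∈ toClopens U ↔ z ∈ toClopens U
    rw [f.apply_symm_apply]
  · refine Clopens.ext (Set.ext fun z => ?_)
    change f.symm (f z) ∈ toClopens U ↔ z ∈ toClopens U
    rw [f.symm_apply_apply]

end Limit

end FreeGroupShift

theorem corollary5p12 (d : ℕ) (hd : 1 ≤ d) :
    FirstOrder.Language.IsFraisse (soficMinimalClass (FreeGroup (Fin d))) ∧
    ∃ ξ₀ : MinCantorAction (FreeGroup (Fin d)),
      conjClass ξ₀ ∈ residual (MinCantorAction (FreeGroup (Fin d))) ∧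
      ∀ ξ ∈ conjClass ξ₀,
        FirstOrder.Language.IsFraisseLimit (soficMinimalClass (FreeGroup (Fin d))) (ClopenAlg ξ.1) := by
  have hne : Nonempty (MinCantorAction (FreeGroup (Fin d))) := by
    refine FreeGroupShift.nonempty_minCantorAction (FreeGroup.lift fun _ => Multiplicative.ofAdd 1) fun y =>
      ⟨FreeGroup.of ⟨0, hd⟩ ^ Multiplicative.toAdd y, ?_⟩
    rw [map_zpow, FreeGroup.lift_apply_of, ← ofAdd_zsmul]
    simp
  have hres := FreeGroupShift.residual_isGenericAction hd
  obtain ⟨ξ₀, hξ₀⟩ := (dense_of_mem_residual hres).nonempty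
  have hlim := FreeGroupShift.IsGenericAction.isFraisseLimit hd hξ₀
  refine ⟨hlim.isFraisse, ξ₀, Filter.mem_of_superset hres fun ξ hξ => ?_, fun ξ hξ => ?_⟩
  · obtain ⟨e⟩ := hlim.nonempty_equiv (FreeGroupShift.IsGenericAction.isFraisseLimit hd hξ)
    exact FreeGroupShift.mem_conjClass_of_equiv e
  · obtain ⟨e⟩ := FreeGroupShift.nonempty_equiv_of_mem_conjClass hξ
    exact ⟨hlim.ultrahomogeneous.of_equiv e, e.age_eq_age.trans hlim.age⟩
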